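/- **Setting.** An instance $I$ of Best-1-Arm with $n\ge 2$ arms consists of $n$ probability distributions $\mathcal D_1,\dots,\mathcal D_n$ on $\mathbb R$ with means $\mu_i\in[0,1]$, each of which is $1$-sub-Gaussian, i.e. $\mathbb E_{X\sim\mathcal D_i}[e^{t(X-\mu_i)}]\le e^{t^2/2}$ for all $t\in\mathbb R$, and such that the largest mean is attained by exactly one arm (the best arm). Let $\mu_{[1]}>\mu_{[2]}\ge\dots\ge\mu_{[n]}$ be the sorted means and $\Delta_{[i]}=\mu_{[1]}-\mu_{[i]}$ the gaps. For an integer $s\ge 1$ let $U^s$ be the set of arms whose gap $\Delta$ satisfies $2^{-s}\le\Delta<2^{-s+1}$, and let $k(I)$ be the number of $s\ge1$ with $U^s\neq\emptyset$. (A family of instances is called clustered if $k(I)$ is bounded by a constant on it.) An algorithm knows $n$ and $\delta$; at each step it may, depending on its internal randomness and on the arms pulled and rewards seen so far, either pull an arm and observe a fresh independent reward from its distribution, or stop and output an arm. It is $\delta$-correct if on every instance with $n$ arms it stops and outputs the best arm with probability at least $1-\delta$. Let $T_{\mathbb A}(I)$ be the expected total number of pulls of $\mathbb A$ on $I$. **Theorem.**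 There are algorithms $\mathbb A_{\delta,n}$ (for $0<\delta<0.1$ and $n\ge 2$) such that every $\mathbb A_{\delta,n}$ is $\delta$-correct, and such that for every $K\in\mathbb N$ there is a constant $C>0$, depending only on $K$, with $$T_{\mathbb A_{\delta,n}}(I)\;\le\; C\left(\sum_{i=2}^{n}\Delta_{[i]}^{-2}\,\ln\delta^{-1}+\Delta_{[2]}^{-2}\,\max\{0,\ln\ln\Delta_{[2]}^{-1}\}\right)$$ for all $0<\delta<0.1$, all $n\ge2$ and all instances $I$ with $n$ arms and $k(I)\le K$. (Here $\ln\ln\Delta_{[2]}^{-1}$ is read as $-\infty$ when $\Delta_{[2]}=1$.) -/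

import Mathlib

open MeasureTheory ProbabilityTheory
open scoped ENNReal

noncomputable section

/-- An instance of the best-arm problem with `n` arms. -/
structure BestArmInstance (n : ℕ) where
  /-- the reward distributions -/
  law : Fin n → Measure ℝ
  isProb : ∀ i, IsProbabilityMeasure (law i)
  mean_mem : ∀ i, (∫ x, x ∂(law i)) ∈ Set.Icc (0 : ℝ) 1
  /-- every reward distribution is `1`-sub-Gaussian: the centred reward has a moment generating
  function that is everywhere finite and at most `exp (t ^ 2 / 2)` -/
  subGaussian : ∀ i, HasSubgaussianMGF (fun x : ℝ => x - ∫ y, y ∂(law i)) 1 (law i)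
  /-- the largest mean is strictly larger than all the others -/
  exists_best : ∃ b, ∀ i, i ≠ b → (∫ x, x ∂(law i)) < ∫ x, x ∂(law b)

namespace BestArmInstance

variable {n : ℕ} (I : BestArmInstance n)

/-- The mean of an arm. -/
def mean (i : Fin n) : ℝ := ∫ x, x ∂(I.law i)

/-- The arm with the largest mean. -/
def best : Fin n := I.exists_best.choose

theorem mean_lt_mean_best {i : Fin n} (hi : i ≠ I.best) : I.mean i < I.mean I.best :=
  I.exists_best.choose_spec i hi

/-- The gap of an arm: the largest mean minus the mean of the arm. -/
def gap (i : Fin n) : ℝ := I.mean I.best - I.mean i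

/-- The difference of the largest and the second largest mean (for `2 ≤ n`), that is, the
smallest gap of an arm other than the best one. -/
def minGap : ℝ := ⨅ i : {i : Fin n // i ≠ I.best}, I.gap i

/-- The dyadic gap class of index `s`: the arms with `2 ^ (-s) ≤ gap < 2 ^ (-s + 1)`. -/
def gapClass (s : ℕ) : Set (Fin n) :=
  {i | (2 : ℝ) ^ (-(s : ℤ)) ≤ I.gap i ∧ I.gap i < (2 : ℝ) ^ (-(s : ℤ) + 1)}

/-- The number of nonempty dyadic gap classes of index at least `1`. -/
def numClasses : ℕ∞ := {s : ℕ | 1 ≤ s ∧ (I.gapClass s).Nonempty}.encard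

/-- The sum, over all arms but the best one, of the inverse squares of the gaps. -/
def complexity : ℝ := ∑ i ∈ Finset.univ.erase I.best, (I.gap i ^ 2)⁻¹

/-- The law of a table of rewards `x`, all independent, in which `x t i` has the distribution of
arm `i`. A player who pulls arm `i` at time `t` is shown the entry `x t i` and no other entry of
row `t`, so each pull of an arm yields a fresh independent sample of its distribution. -/
def rewardLaw : Measure (ℕ → Fin n → ℝ) :=
  Measure.infinitePi (fun _ : ℕ => Measure.pi I.law)

end BestArmInstance

/-- The record of the first `t` rounds: the arm pulled and the reward seen in each of them. -/
abbrev PullHistory (n t : ℕ) : Type := Fin t → Fin n × ℝ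

/-- A (randomized, adaptive) algorithm for the best-arm problem with `n` arms: a source of
internal randomness, a sampling rule, a stopping rule and a recommendation rule. At time `t` all
rules see the internal randomness and the first `t` rounds only. -/
structure BanditAlgorithm (n : ℕ) where
  Seed : Type
  [measurableSpaceSeed : MeasurableSpace Seed]
  seedLaw : Measure Seed
  isProb : IsProbabilityMeasure seedLaw
  pull : (t : ℕ) → Seed × PullHistory n t → Fin n
  measurable_pull : ∀ t, Measurable (pull t)
  stopRule : (t : ℕ) → Set (Seed × PullHistory n t)
  measurableSet_stopRule : ∀ t, MeasurableSet (stopRule t)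
  answer : (t : ℕ) → Seed × PullHistory n t → Fin n
  measurable_answer : ∀ t, Measurable (answer t)

attribute [instance] BanditAlgorithm.measurableSpaceSeed

namespace BanditAlgorithm

variable {n : ℕ} (A : BanditAlgorithm n)

/-- The first `t` rounds of the sampling rule for the seed `u` and the reward table `x` (continued
for all times; what happens after the stopping time is never used). -/
def history (u : A.Seed) (x : ℕ → Fin n → ℝ) : (t : ℕ) → PullHistory n t
  | 0 => Fin.elim0
  | t + 1 =>
    Fin.snoc (α := fun _ => Fin n × ℝ) (history u x t)
      (A.pull t (u, history u x t), x t (A.pull t (u, history u x t)))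

/-- The times at which the stopping rule tells the algorithm to stop. -/
def stopTimes (ω : A.Seed × (ℕ → Fin n → ℝ)) : Set ℕ :=
  {t | (ω.1, A.history ω.1 ω.2 t) ∈ A.stopRule t}

/-- The total number of samples: the first time at which the algorithm stops, `∞` if there is
none. -/
def numSamples (ω : A.Seed × (ℕ → Fin n → ℝ)) : ℝ≥0∞ :=
  ⨅ t ∈ A.stopTimes ω, (t : ℝ≥0∞)

/-- The event that the algorithm stops and then answers `b`. -/
def returns (b : Fin n) : Set (A.Seed × (ℕ → Fin n → ℝ)) :=
  {ω | ∃ t, IsLeast (A.stopTimes ω) t ∧ A.answer t (ω.1, A.history ω.1 ω.2 t) = b}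

/-- The joint law of the internal randomness and of the reward table on the instance `I`. -/
def runLaw (I : BestArmInstance n) : Measure (A.Seed × (ℕ → Fin n → ℝ)) :=
  A.seedLaw.prod I.rewardLaw

/-- The expected number of samples on the instance `I`. -/
def expectedSamples (I : BestArmInstance n) : ℝ≥0∞ :=
  ∫⁻ ω, A.numSamples ω ∂(A.runLaw I)

/-- On every instance with `n` arms, the algorithm returns the best arm with probability at least
`1 - δ`. -/
def IsCorrect (δ : ℝ) : Prop :=
  ∀ I : BestArmInstance n, ENNReal.ofReal (1 - δ) ≤ A.runLaw I (A.returns I.best)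

end BanditAlgorithm

end

open MeasureTheory ProbabilityTheory
open scoped ENNReal
set_option linter.unusedSectionVars false

noncomputable section

/-! The algorithm interleaves copies of one elimination procedure, run at increasing confidence
levels `c`. In round `r`, with accuracy `ε = 2 ^ (-r)`, the procedure halves the surviving set `S`
by empirical means down to one winner, which should have gap at most `ε / 8`. It then tests whether
a constant fraction of `S` is clearly worse than the winner. Only after a positive test does it
sample all of `S` at full confidence and eliminate; it then repeats the tournament and the test in
the same round. A negative test ends the round.

The test is the only step whose confidence level must grow with `r`, by about `2 log₂ (r + 2)`. It
fails only if the winner or a sixteenth of all arms are misestimated, so its level can be shared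
among the arms, and its cost is `4 ^ r` times `O(|S| + level)`. The doubly logarithmic term is
therefore multiplied by the geometric sum of the `4 ^ r`, that is by `Δ_[2] ^ (-2)`, and not by the
whole complexity.

Tournaments and eliminations get levels that depend on the number `h` of earlier rounds with
eliminations instead of `r`. This suffices for two reasons. In a round whose gap class is empty, the
first tournament may fail harmlessly: no arm becomes far in that round (`far_eq_of_notMem_classes`),
and an elimination against a bad winner still spares the best arm. Moreover, the two thresholds of
the test force every new round with eliminations to uncover an arm with a smaller gap than the last
such round had treated, so `h` is bounded by three times the number of classes plus one
(`elimCount_lt`, `Healthy.h_le`).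

Potentials do the bookkeeping. `lossBound` bounds the probability of a wrong answer on every
instance, whatever its number of classes (`iterate_op_mistaken_le`). `failBound` and `costBound`
give success within the desired number of pulls, except with probability `O(K) exp (-c)`
(`iterate_op_unsuccessful_le`). Since a single copy is controlled only on a likely event, copy `i`
gets a fraction `2 ^ (-i - 1)` of the time and failure probability of order `8 ^ (-i)`; the expected
time is then a convergent series (`expectedSamples_interleave_le`). -/

/-- The law of the vector of sums of rewards, arm by arm, when the arms of a list are pulled one
after the other. -/
def epochLaw {n : ℕ} (law : Fin n → Measure ℝ) : List (Fin n) → Measure (Fin n → ℝ)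
  | [] => Measure.dirac 0
  | i :: w => ((law i).prod (epochLaw law w)).map (fun p => Pi.single i p.1 + p.2)

/-! ### Expectations over one epoch of pulls. -/

section epochLaw

variable {n : ℕ}

theorem measurable_single_add (i : Fin n) :
    Measurable (fun p : ℝ × (Fin n → ℝ) => (Pi.single i p.1 + p.2 : Fin n → ℝ)) := by
  refine Measurable.add ?_ measurable_snd
  rw [measurable_pi_iff]
  intro j
  by_cases h : j = i
  · subst h; simpa using measurable_fst
  · simp [Pi.single_eq_of_ne h]

instance isProbabilityMeasure_epochLaw (law : Fin n → Measure ℝ)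
    [∀ i, IsProbabilityMeasure (law i)] (w : List (Fin n)) :
    IsProbabilityMeasure (epochLaw law w) := by
  induction w with
  | nil => unfold epochLaw; infer_instance
  | cons i w ih =>
    unfold epochLaw
    exact Measure.isProbabilityMeasure_map (measurable_single_add i).aemeasurable

theorem lintegral_epochLaw_nil (law : Fin n → Measure ℝ) {f : (Fin n → ℝ) → ℝ≥0∞}
    (hf : Measurable f) : ∫⁻ y, f y ∂epochLaw law [] = f 0 := by
  unfold epochLaw; rw [lintegral_dirac' _ hf]

theorem lintegral_epochLaw_cons (law : Fin n → Measure ℝ) [∀ i, IsProbabilityMeasure (law i)]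
    (i : Fin n) (w : List (Fin n)) {f : (Fin n → ℝ) → ℝ≥0∞} (hf : Measurable f) :
    ∫⁻ y, f y ∂epochLaw law (i :: w) =
      ∫⁻ z, ∫⁻ y, f (Pi.single i z + y) ∂epochLaw law w ∂law i := by
  rw [epochLaw, lintegral_map hf (measurable_single_add i), lintegral_prod]
  exact (hf.comp (measurable_single_add i)).aemeasurable

end epochLaw

/-! ### Exponential moments and deviations of many arms at once. -/

namespace BestArmInstance

variable {n : ℕ} (I : BestArmInstance n)

instance isProbabilityMeasure_law (i : Fin n) : IsProbabilityMeasure (I.law i) := I.isProb i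

theorem lintegral_exp_le (i : Fin n) (t : ℝ) :
    ∫⁻ z, ENNReal.ofReal (Real.exp (t * z)) ∂I.law i ≤
      ENNReal.ofReal (Real.exp (t * I.mean i + t ^ 2 / 2)) := by
  have h := I.subGaussian i
  have hint := h.integrable_exp_mul t
  have hmgf := h.mgf_le t
  unfold mgf at hmgf
  have e : ∀ z : ℝ, ENNReal.ofReal (Real.exp (t * z)) =
      ENNReal.ofReal (Real.exp (t * I.mean i)) *
        ENNReal.ofReal (Real.exp (t * (z - ∫ y, y ∂(I.law i)))) := by
    intro z
    rw [← ENNReal.ofReal_mul (Real.exp_nonneg _), ← Real.exp_add]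
    congr 2; unfold mean; ring
  rw [lintegral_congr e, lintegral_const_mul' _ _ ENNReal.ofReal_ne_top,
    ← ofReal_integral_eq_lintegral_ofReal hint (.of_forall fun _ => Real.exp_nonneg _),
    ← ENNReal.ofReal_mul (Real.exp_nonneg _), Real.exp_add]
  refine ENNReal.ofReal_le_ofReal (mul_le_mul_of_nonneg_left ?_ (Real.exp_nonneg _))
  simpa using hmgf

theorem lintegral_epochLaw_exp_le (t : Fin n → ℝ) (w : List (Fin n)) :
    ∫⁻ y, ENNReal.ofReal (Real.exp (∑ i, t i * y i)) ∂epochLaw I.law w ≤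
      ENNReal.ofReal (Real.exp ((w.map fun i => t i * I.mean i + t i ^ 2 / 2).sum)) := by
  have hm : Measurable fun y : Fin n → ℝ => ENNReal.ofReal (Real.exp (∑ i, t i * y i)) := by
    fun_prop
  induction w with
  | nil => rw [lintegral_epochLaw_nil _ hm]; simp
  | cons i w ih =>
    rw [lintegral_epochLaw_cons _ _ _ hm]
    have e : ∀ (z : ℝ) (y : Fin n → ℝ),
        ENNReal.ofReal (Real.exp (∑ j, t j * (Pi.single i z + y : Fin n → ℝ) j)) =
          ENNReal.ofReal (Real.exp (t i * z)) * ENNReal.ofReal (Real.exp (∑ j, t j * y j)) := by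
      intro z y
      rw [← ENNReal.ofReal_mul (Real.exp_nonneg _), ← Real.exp_add]
      congr 2
      simp [mul_add, Finset.sum_add_distrib, Pi.single_apply]
    simp_rw [e]
    simp_rw [lintegral_const_mul' _ _ ENNReal.ofReal_ne_top]
    rw [lintegral_mul_const _ (by fun_prop)]
    rw [List.map_cons, List.sum_cons, Real.exp_add, ENNReal.ofReal_mul (Real.exp_nonneg _)]
    exact mul_le_mul' (I.lintegral_exp_le i (t i)) ih

theorem sum_map_eq_sum_count (w : List (Fin n)) (g : Fin n → ℝ) :
    (w.map g).sum = ∑ i, (w.count i : ℝ) * g i := by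
  rw [Finset.sum_list_map_count]
  simp only [nsmul_eq_mul]
  refine Finset.sum_subset (Finset.subset_univ _) fun i _ hi => ?_
  rw [List.mem_toFinset] at hi
  simp [List.count_eq_zero_of_not_mem hi]

/-- The arms of `S` whose empirical sum deviates by at least `a` per pull in the direction `ς`. -/
def deviants (w : List (Fin n)) (S : Finset (Fin n)) (ς a : ℝ) (y : Fin n → ℝ) :
    Finset (Fin n) :=
  open Classical in S.filter fun i => w.count i * a ≤ ς * (y i - w.count i * I.mean i)

/-- Chernoff's bound for the joint exponential moment with parameter `ς * a` at the arms of `A` and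
`0` elsewhere: by independence the exponents add up over `A`. -/
theorem measure_subset_deviants_le (w : List (Fin n)) (S A : Finset (Fin n)) {ς a k : ℝ}
    (hς : ς ^ 2 = 1) (ha : 0 ≤ a) (hk : ∀ i ∈ A, k ≤ w.count i * a ^ 2 / 2) :
    epochLaw I.law w {y | A ⊆ I.deviants w S ς a y} ≤
      ENNReal.ofReal (Real.exp (-(A.card * k))) := by
  classical
  set t : Fin n → ℝ := fun i => if i ∈ A then ς * a else 0 with ht
  set B : ℝ := ∑ i ∈ A, (ς * a * (w.count i * I.mean i) + w.count i * a ^ 2) with hB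
  have h1 : {y | A ⊆ I.deviants w S ς a y} ⊆
      {y | ENNReal.ofReal (Real.exp B) ≤ ENNReal.ofReal (Real.exp (∑ i, t i * y i))} := by
    intro y hy
    refine ENNReal.ofReal_le_ofReal (Real.exp_le_exp.2 ?_)
    simp only [ht, ite_mul, zero_mul, Finset.sum_ite_mem, Finset.univ_inter]
    refine Finset.sum_le_sum fun i hi => ?_
    have := hy hi
    simp only [deviants, Finset.mem_filter] at this
    nlinarith [mul_le_mul_of_nonneg_left this.2 ha]
  have hm : ∀ t : Fin n → ℝ, Measurable fun y : Fin n → ℝ =>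
      ENNReal.ofReal (Real.exp (∑ i, t i * y i)) := fun t => by fun_prop
  refine (measure_mono h1).trans ((meas_ge_le_lintegral_div (hm t).aemeasurable (by
    simp [Real.exp_pos]) ENNReal.ofReal_ne_top).trans ?_)
  refine ENNReal.div_le_of_le_mul ((I.lintegral_epochLaw_exp_le t w).trans ?_)
  rw [← ENNReal.ofReal_mul (Real.exp_nonneg _), ← Real.exp_add]
  refine ENNReal.ofReal_le_ofReal (Real.exp_le_exp.2 ?_)
  rw [sum_map_eq_sum_count, hB]
  have e : ∑ i, (w.count i : ℝ) * (t i * I.mean i + t i ^ 2 / 2) =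
      ∑ i ∈ A, (w.count i : ℝ) * (ς * a * I.mean i + (ς * a) ^ 2 / 2) := by
    rw [← Finset.sum_filter_add_sum_filter_not Finset.univ (fun i => i ∈ A)]
    rw [Finset.sum_eq_zero (s := Finset.univ.filter fun i => i ∉ A)]
    · rw [add_zero, Finset.filter_mem_eq_inter, Finset.univ_inter]
      exact Finset.sum_congr rfl fun i hi => by simp [ht, hi]
    · intro i hi
      simp only [Finset.mem_filter] at hi
      simp [ht, hi.2]
  rw [e, ← nsmul_eq_mul, ← Finset.sum_const, ← Finset.sum_neg_distrib, ← Finset.sum_add_distrib]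
  refine Finset.sum_le_sum fun i hi => ?_
  have := hk i hi
  rw [mul_pow, hς]
  nlinarith

/-- With high probability only few arms deviate. -/
theorem measure_card_deviants_le (w : List (Fin n)) (S : Finset (Fin n)) {ς a k : ℝ} {t : ℕ}
    (hς : ς ^ 2 = 1) (ha : 0 ≤ a) (hS : S.card ≤ 16 * t)
    (hk : ∀ i ∈ S, k + 12 ≤ w.count i * a ^ 2 / 2) :
    epochLaw I.law w {y | t ≤ (I.deviants w S ς a y).card} ≤
      ENNReal.ofReal (Real.exp (-(t * k))) := by
  classical
  have h1 : {y | t ≤ (I.deviants w S ς a y).card} ⊆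
      ⋃ A ∈ Finset.powersetCard t S, {y | A ⊆ I.deviants w S ς a y} := by
    intro y hy
    obtain ⟨A, hA, hc⟩ := Finset.exists_subset_card_eq hy
    simp only [Set.mem_iUnion]
    exact ⟨A, Finset.mem_powersetCard.2 ⟨hA.trans (Finset.filter_subset _ _), hc⟩, hA⟩
  refine (measure_mono h1).trans ((measure_biUnion_finset_le _ _).trans ?_)
  have h2 : ∀ A ∈ Finset.powersetCard t S,
      epochLaw I.law w {y | A ⊆ I.deviants w S ς a y} ≤
        ENNReal.ofReal (Real.exp (-(t * (k + 12)))) := by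
    intro A hA
    obtain ⟨hA, hc⟩ := Finset.mem_powersetCard.1 hA
    have := I.measure_subset_deviants_le w S A hς ha (k := k + 12) fun i hi => hk i (hA hi)
    rwa [hc] at this
  refine (Finset.sum_le_card_nsmul _ _ _ h2).trans ?_
  rw [Finset.card_powersetCard, nsmul_eq_mul, ← ENNReal.ofReal_natCast,
    ← ENNReal.ofReal_mul (Nat.cast_nonneg _)]
  refine ENNReal.ofReal_le_ofReal ?_
  -- The union bound runs over at most `2 ^ (16 * t)` sets, and `2 ^ 16 ≤ 2.7 ^ 12`. This is the
  -- source of the summand `12` in all numbers of pulls.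
  have h3 : (S.card.choose t : ℝ) ≤ Real.exp (12 * t) := by
    have h4 : S.card.choose t ≤ 2 ^ (16 * t) :=
      (Nat.choose_le_two_pow _ _).trans (Nat.pow_le_pow_right (by norm_num) hS)
    have h5 : (S.card.choose t : ℝ) ≤ (2 ^ 16 : ℝ) ^ t := by
      rw [← pow_mul]; exact_mod_cast h4
    refine h5.trans ?_
    rw [mul_comm, Real.exp_nat_mul]
    refine pow_le_pow_left₀ (by norm_num) ?_ _
    have h6 : (2.7 : ℝ) < Real.exp 1 := by linarith [Real.exp_one_gt_d9]
    have h7 : Real.exp 12 = Real.exp 1 ^ 12 := by rw [← Real.exp_nat_mul]; norm_num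
    rw [h7]
    exact (by norm_num : (2 : ℝ) ^ 16 ≤ 2.7 ^ 12).trans (pow_le_pow_left₀ (by norm_num) h6.le _)
  refine (mul_le_mul_of_nonneg_right h3 (Real.exp_nonneg _)).trans ?_
  rw [← Real.exp_add]
  exact Real.exp_le_exp.2 (by linarith)

end BestArmInstance

/-! ### Epoch machines as Markov chains. -/

instance measurableSpaceListFin {n : ℕ} : MeasurableSpace (List (Fin n)) := ⊤

instance discreteMeasurableSpaceListFin {n : ℕ} : DiscreteMeasurableSpace (List (Fin n)) :=
  ⟨fun _ => trivial⟩

/-- A sampling procedure that works in epochs: in the state `s` the arms in the list `plan s` are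
pulled, and the next state is a function of the vector of the sums of the rewards of this epoch,
arm by arm. The procedure halts, with answer `out s`, when `plan s` is empty. -/
structure EpochMachine (n : ℕ) (σ : Type) [MeasurableSpace σ] where
  init : σ
  plan : σ → List (Fin n)
  next : σ → (Fin n → ℝ) → σ
  measurable_next : ∀ s, Measurable (next s)
  out : σ → Fin n

/-- The configurations of an epoch machine: the current state, the pulls that remain in the current
epoch, and the sums of the rewards of the epoch so far. -/
abbrev EpochConfig (n : ℕ) (σ : Type) : Type := (σ × List (Fin n)) × (Fin n → ℝ)

namespace EpochMachine

variable {n : ℕ} {σ : Type} [MeasurableSpace σ] (M : EpochMachine n σ)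

def start (s : σ) : EpochConfig n σ := ((s, M.plan s), 0)

def pull (c : EpochConfig n σ) : Fin n := c.1.2.headD (M.out c.1.1)

/-- One pull, with reward `z`. -/
def step (c : EpochConfig n σ) (z : ℝ) : EpochConfig n σ :=
  match c with
  | ((s, []), y) => ((s, []), y)
  | ((s, i :: w), y) =>
    -- The next epoch is entered at once, so along a run an empty list of pending pulls means that
    -- the machine has halted.
    if w = [] then M.start (M.next s (y + Pi.single i z)) else ((s, w), y + Pi.single i z)

/-- The transition operator of the Markov chain of the configurations. -/
def op (law : Fin n → Measure ℝ) (φ : EpochConfig n σ → ℝ≥0∞) (c : EpochConfig n σ) : ℝ≥0∞ :=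
  ∫⁻ z, φ (M.step c z) ∂law (M.pull c)

section measurability

variable [Countable σ] [DiscreteMeasurableSpace σ]

theorem measurable_start : Measurable M.start :=
  Measurable.prodMk (.of_discrete) measurable_const

theorem measurable_pull : Measurable M.pull :=
  (Measurable.of_discrete (f := fun k : σ × List (Fin n) => k.2.headD (M.out k.1))).comp
    measurable_fst

theorem measurable_add_single (i : Fin n) :
    Measurable (fun p : (Fin n → ℝ) × ℝ => (p.1 + Pi.single i p.2 : Fin n → ℝ)) := by
  have h := (measurable_single_add i).comp (measurable_swap (α := Fin n → ℝ) (β := ℝ))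
  have e : (fun p : (Fin n → ℝ) × ℝ => (p.1 + Pi.single i p.2 : Fin n → ℝ)) =
      (fun p : ℝ × (Fin n → ℝ) => (Pi.single i p.1 + p.2 : Fin n → ℝ)) ∘ Prod.swap := by
    ext p; simp [add_comm]
  rwa [e]

theorem measurable_step : Measurable (fun p : EpochConfig n σ × ℝ => M.step p.1 p.2) := by
  have h : Measurable (fun q : (σ × List (Fin n)) × ((Fin n → ℝ) × ℝ) =>
      M.step (q.1, q.2.1) q.2.2) := by
    refine measurable_from_prod_countable_right ?_
    rintro ⟨s, w⟩
    cases w with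
    | nil => exact measurable_const.prodMk measurable_fst
    | cons i w =>
      by_cases hw : w = []
      · simp only [step, hw, if_true]
        exact M.measurable_start.comp ((M.measurable_next s).comp (measurable_add_single i))
      · simp only [step, hw, if_false]
        exact measurable_const.prodMk (measurable_add_single i)
  exact h.comp ((measurable_fst.comp measurable_fst).prodMk
    ((measurable_snd.comp measurable_fst).prodMk measurable_snd))

variable (law : Fin n → Measure ℝ) [∀ i, IsProbabilityMeasure (law i)]

theorem measurable_op {φ : EpochConfig n σ → ℝ≥0∞} (hφ : Measurable φ) :
    Measurable (M.op law φ) := by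
  refine measurable_from_prod_countable_right ?_
  intro k
  exact Measurable.lintegral_prod_right' (ν := law (M.pull (k, 0)))
    (f := fun p : (Fin n → ℝ) × ℝ => φ (M.step (k, p.1) p.2)) (hφ.comp (M.measurable_step.comp
      ((measurable_const.prodMk measurable_fst).prodMk measurable_snd)))

theorem measurable_iterate_op {φ : EpochConfig n σ → ℝ≥0∞} (hφ : Measurable φ) (N : ℕ) :
    Measurable ((M.op law)^[N] φ) := by
  induction N with
  | zero => exact hφ
  | succ N ih => rw [Function.iterate_succ_apply']; exact M.measurable_op law ih

theorem iterate_op_le_one {φ : EpochConfig n σ → ℝ≥0∞} (hφ : ∀ c, φ c ≤ 1) (N : ℕ)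
    (c : EpochConfig n σ) : (M.op law)^[N] φ c ≤ 1 := by
  induction N generalizing c with
  | zero => exact hφ c
  | succ N ih =>
    rw [Function.iterate_succ_apply']
    exact (lintegral_mono fun z => ih _).trans (by simp)

theorem iterate_op_halted (φ : EpochConfig n σ → ℝ≥0∞) (N : ℕ) (s : σ) (y : Fin n → ℝ) :
    (M.op law)^[N] φ ((s, []), y) = φ ((s, []), y) := by
  induction N with
  | zero => rfl
  | succ N ih => rw [Function.iterate_succ_apply']; simp [op, step, ih]

/-- The decomposition of a run at the end of the current epoch. -/
theorem iterate_op_add_length {φ : EpochConfig n σ → ℝ≥0∞} (hφ : Measurable φ) (N : ℕ) (s : σ)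
    (w : List (Fin n)) (hw : w ≠ []) (y : Fin n → ℝ) :
    (M.op law)^[N + w.length] φ ((s, w), y) =
      ∫⁻ y', (M.op law)^[N] φ (M.start (M.next s (y + y'))) ∂epochLaw law w := by
  have hm : ∀ y : Fin n → ℝ,
      Measurable fun y' => (M.op law)^[N] φ (M.start (M.next s (y + y'))) := fun y =>
    (M.measurable_iterate_op law hφ N).comp (M.measurable_start.comp
      ((M.measurable_next s).comp (measurable_const.add measurable_id)))
  induction w generalizing y with
  | nil => exact absurd rfl hw
  | cons i w ih =>
    rw [List.length_cons, ← add_assoc, Function.iterate_succ_apply',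
      lintegral_epochLaw_cons _ _ _ (hm y)]
    refine lintegral_congr fun z => ?_
    by_cases h : w = []
    · subst h
      rw [lintegral_epochLaw_nil]
      · simp [step]
      · exact (hm y).comp (measurable_const.add measurable_id)
    · simp only [step, h, if_false]
      rw [ih h]
      simp_rw [add_assoc]

theorem iterate_op_eq_zero_of_lt {φ : EpochConfig n σ → ℝ≥0∞}
    (hφ : ∀ s w y, w ≠ [] → φ ((s, w), y) = 0) (N : ℕ) (s : σ) (w : List (Fin n))
    (hw : N < w.length) (y : Fin n → ℝ) : (M.op law)^[N] φ ((s, w), y) = 0 := by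
  induction N generalizing w y with
  | zero => exact hφ _ _ _ (by rintro rfl; simp at hw)
  | succ N ih =>
    rw [Function.iterate_succ_apply']
    cases w with
    | nil => simp at hw
    | cons i w =>
      have h : w ≠ [] := by rintro rfl; simp at hw
      simp only [op, step, h, if_false]
      simp [ih w (by simpa using hw)]

/-- Condition on the result of the first epoch and use the trivial bound `1` outside `E`. -/
theorem iterate_op_start_le {φ : EpochConfig n σ → ℝ≥0∞} (hφ : Measurable φ)
    (hφ1 : ∀ c, φ c ≤ 1) (N : ℕ) (s : σ) (hs : M.plan s ≠ []) (E : Set (Fin n → ℝ)) {p q : ℝ}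
    (hp : 0 ≤ p) (hq : 0 ≤ q) (hE : epochLaw law (M.plan s) Eᶜ ≤ ENNReal.ofReal p)
    (h : ∀ y ∈ E, (M.op law)^[N] φ (M.start (M.next s y)) ≤ ENNReal.ofReal q) :
    (M.op law)^[N + (M.plan s).length] φ (M.start s) ≤ ENNReal.ofReal (p + q) := by
  classical
  rw [start, M.iterate_op_add_length law hφ N s _ hs]
  simp only [zero_add]
  calc _ ≤ ∫⁻ y, (ENNReal.ofReal q + Eᶜ.indicator (fun _ => 1) y) ∂epochLaw law (M.plan s) := by
        refine lintegral_mono fun y => ?_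
        by_cases hy : y ∈ E
        · exact (h y hy).trans le_self_add
        · simp only [Set.indicator, Set.mem_compl_iff, hy, not_false_iff, if_true]
          exact (M.iterate_op_le_one law hφ1 N _).trans le_add_self
    _ ≤ ENNReal.ofReal q + ENNReal.ofReal p := by
        rw [lintegral_add_left measurable_const]
        refine add_le_add (by simp) ((lintegral_indicator_const_le _ _).trans ?_)
        rwa [one_mul]
    _ = _ := by rw [add_comm, ENNReal.ofReal_add hp hq]

/-- A bound on the probability that the machine has not reached a null set of `φ` within a given
number of pulls, from a potential `V` for the number of pulls and a potential `W` for the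
probability. -/
theorem iterate_op_start_le_of_potential {φ : EpochConfig n σ → ℝ≥0∞} (hφ : Measurable φ)
    (hφ1 : ∀ c, φ c ≤ 1) (Good : σ → Prop) (V W : σ → ℝ)
    (hhalt : ∀ s, Good s → M.plan s = [] → φ (M.start s) = 0)
    (hstep : ∀ s, Good s → M.plan s ≠ [] → ∃ (E : Set (Fin n → ℝ)) (p q v : ℝ),
      0 ≤ p ∧ 0 ≤ q ∧ 0 ≤ v ∧ epochLaw law (M.plan s) Eᶜ ≤ ENNReal.ofReal p ∧ p + q ≤ W s ∧
      (M.plan s).length + v ≤ V s ∧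
      ∀ y ∈ E, Good (M.next s y) ∧ W (M.next s y) ≤ q ∧ V (M.next s y) ≤ v)
    (N : ℕ) (s : σ) (hs : Good s) (hN : V s ≤ N) :
    (M.op law)^[N] φ (M.start s) ≤ ENNReal.ofReal (W s) := by
  induction N using Nat.strong_induction_on generalizing s with
  | _ N ih =>
    by_cases h : M.plan s = []
    · have := hhalt s hs h
      rw [start, h] at this ⊢
      rw [iterate_op_halted, this]
      exact zero_le
    · obtain ⟨E, p, q, v, hp, hq, hv, hE, hW, hV, hnext⟩ := hstep s hs h
      have hlen : (M.plan s).length ≤ N := by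
        have : ((M.plan s).length : ℝ) ≤ N := by linarith
        exact_mod_cast this
      obtain ⟨N', rfl⟩ := Nat.exists_eq_add_of_le' hlen
      refine (M.iterate_op_start_le law hφ hφ1 N' s h E hp hq hE fun y hy => ?_).trans
        (ENNReal.ofReal_le_ofReal hW)
      obtain ⟨h1, h2, h3⟩ := hnext y hy
      refine (ih N' ?_ _ h1 ?_).trans (ENNReal.ofReal_le_ofReal h2)
      · have := List.length_pos_iff.2 h; omega
      · push_cast at hN; linarith

/-- A bound, uniform in time, on the probability that the machine has halted outside a null set
of `φ`. -/
theorem iterate_op_start_le_of_invariant {φ : EpochConfig n σ → ℝ≥0∞} (hφ : Measurable φ)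
    (hφ1 : ∀ c, φ c ≤ 1) (hφ0 : ∀ s w y, w ≠ [] → φ ((s, w), y) = 0) (Good : σ → Prop) (W : σ → ℝ)
    (hhalt : ∀ s, Good s → M.plan s = [] → φ (M.start s) = 0)
    (hstep : ∀ s, Good s → M.plan s ≠ [] → ∃ (E : Set (Fin n → ℝ)) (p q : ℝ),
      0 ≤ p ∧ 0 ≤ q ∧ epochLaw law (M.plan s) Eᶜ ≤ ENNReal.ofReal p ∧ p + q ≤ W s ∧
      ∀ y ∈ E, Good (M.next s y) ∧ W (M.next s y) ≤ q)
    (N : ℕ) (s : σ) (hs : Good s) :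
    (M.op law)^[N] φ (M.start s) ≤ ENNReal.ofReal (W s) := by
  induction N using Nat.strong_induction_on generalizing s with
  | _ N ih =>
    by_cases h : M.plan s = []
    · have := hhalt s hs h
      rw [start, h] at this ⊢
      rw [iterate_op_halted, this]
      exact zero_le
    -- Time is not budgeted here, so `N` may fall inside the epoch; `φ` then vanishes because the
    -- machine has not halted.
    · by_cases hlen : N < (M.plan s).length
      · rw [start, M.iterate_op_eq_zero_of_lt law hφ0 N s _ hlen]
        exact zero_le
      obtain ⟨E, p, q, hp, hq, hE, hW, hnext⟩ := hstep s hs h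
      obtain ⟨N', rfl⟩ := Nat.exists_eq_add_of_le' (not_lt.1 hlen)
      refine (M.iterate_op_start_le law hφ hφ1 N' s h E hp hq hE fun y hy => ?_).trans
        (ENNReal.ofReal_le_ofReal hW)
      obtain ⟨h1, h2⟩ := hnext y hy
      refine (ih N' ?_ _ h1).trans (ENNReal.ofReal_le_ofReal h2)
      have := List.length_pos_iff.2 h; omega

end measurability

end EpochMachine

/-! ### Resampling a row of the reward table. -/

namespace BestArmInstance

variable {n : ℕ} (I : BestArmInstance n)

instance isProbabilityMeasure_rewardLaw : IsProbabilityMeasure I.rewardLaw := by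
  unfold rewardLaw; infer_instance

theorem measurable_update_prod (t : ℕ) :
    Measurable fun p : (ℕ → Fin n → ℝ) × (Fin n → ℝ) => Function.update p.1 t p.2 := by
  rw [measurable_pi_iff]
  intro s
  by_cases h : s = t
  · subst h; simpa using measurable_snd
  · simp only [Function.update_of_ne h]
    exact (measurable_pi_apply s).comp measurable_fst

/-- Resampling one row of the table of rewards does not change its law. -/
theorem map_update_rewardLaw (t : ℕ) :
    (I.rewardLaw.prod (Measure.pi I.law)).map
      (fun p : (ℕ → Fin n → ℝ) × (Fin n → ℝ) => Function.update p.1 t p.2) = I.rewardLaw := by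
  refine Measure.eq_infinitePi _ fun s T hT => ?_
  rw [Measure.map_apply (measurable_update_prod t) (MeasurableSet.pi s.countable_toSet
    fun i _ => hT i)]
  by_cases hts : t ∈ s
  · have e : (fun p : (ℕ → Fin n → ℝ) × (Fin n → ℝ) => Function.update p.1 t p.2) ⁻¹'
        (s : Set ℕ).pi T = (((s.erase t : Finset ℕ) : Set ℕ).pi T) ×ˢ T t := by
      ext p
      simp only [Set.mem_preimage, Set.mem_pi, Set.mem_prod, Finset.mem_coe, Finset.mem_erase]
      constructor
      · intro h
        refine ⟨fun i hi => ?_, by simpa using h t hts⟩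
        simpa [Function.update_of_ne hi.1] using h i hi.2
      · rintro ⟨h1, h2⟩ i hi
        by_cases hit : i = t
        · subst hit; simpa using h2
        · rw [Function.update_of_ne hit]; exact h1 i ⟨hit, hi⟩
    rw [e, Measure.prod_prod, rewardLaw, Measure.infinitePi_pi _ (fun i _ => hT i),
      Finset.prod_erase_mul _ _ hts]
  · have e : (fun p : (ℕ → Fin n → ℝ) × (Fin n → ℝ) => Function.update p.1 t p.2) ⁻¹'
        (s : Set ℕ).pi T = ((s : Set ℕ).pi T) ×ˢ Set.univ := by
      ext p
      simp only [Set.mem_preimage, Set.mem_pi, Set.mem_prod, Finset.mem_coe, Set.mem_univ,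
        and_true]
      refine forall₂_congr fun i hi => ?_
      rw [Function.update_of_ne (by rintro rfl; exact hts hi)]
    rw [e, Measure.prod_prod, rewardLaw, Measure.infinitePi_pi _ (fun i _ => hT i), measure_univ,
      mul_one]

theorem lintegral_rewardLaw_update (t : ℕ) {H : (ℕ → Fin n → ℝ) → ℝ≥0∞} (hH : Measurable H) :
    ∫⁻ x, H x ∂I.rewardLaw =
      ∫⁻ x, ∫⁻ v, H (Function.update x t v) ∂Measure.pi I.law ∂I.rewardLaw := by
  conv_lhs => rw [← I.map_update_rewardLaw t]
  rw [lintegral_map hH (measurable_update_prod t), lintegral_prod]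
  exact (hH.comp (measurable_update_prod t)).aemeasurable

theorem lintegral_pi_law_eval (i : Fin n) {H : ℝ → ℝ≥0∞} (hH : Measurable H) :
    ∫⁻ v, H (v i) ∂Measure.pi I.law = ∫⁻ z, H z ∂I.law i := by
  rw [← (measurePreserving_eval I.law i).map_eq, lintegral_map hH (measurable_pi_apply i)]

end BestArmInstance

/-! ### Interleaving the copies into a bandit algorithm. -/

namespace EpochMachine

/-- The schedule of the interleaved copies: the copy `i` is run at a fraction `2 ^ (-i - 1)` of all
times. -/
def schedule (t : ℕ) : ℕ := padicValNat 2 (t + 1)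

/-- The times `2 ^ i * (2 * k + 1) - 1` with `k < N` belong to copy `i` and lie below `2 ^ (i + 1) *
N`. -/
theorem le_count_schedule (i N : ℕ) :
    N ≤ Nat.count (fun t => schedule t = i) (2 ^ (i + 1) * N) := by
  rw [Nat.count_eq_card_filter_range]
  conv_lhs => rw [← Finset.card_range N]
  refine Finset.card_le_card_of_injOn (fun k => 2 ^ i * (2 * k + 1) - 1) ?_ ?_
  · intro k hk
    have hk : k < N := by simpa using hk
    have h0 : 0 < 2 ^ i * (2 * k + 1) := by positivity
    have h1 : 2 ^ i * (2 * k + 1) < 2 ^ i * (2 * N) :=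
      Nat.mul_lt_mul_of_pos_left (by omega) (by positivity)
    simp only [Finset.coe_filter, Finset.mem_range]
    refine ⟨?_, ?_⟩
    · rw [pow_succ, mul_assoc]; omega
    · unfold schedule
      rw [Nat.sub_add_cancel h0, padicValNat.mul (by positivity) (by omega),
        padicValNat.prime_pow, padicValNat.eq_zero_of_not_dvd (by omega), add_zero]
  · intro k _ l _ h
    have h0 : 0 < 2 ^ i * (2 * k + 1) := by positivity
    have h1 : 0 < 2 ^ i * (2 * l + 1) := by positivity
    have h2 : 2 ^ i * (2 * k + 1) = 2 ^ i * (2 * l + 1) := by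
      simp only at h; omega
    have := Nat.eq_of_mul_eq_mul_left (by positivity) h2
    omega

variable {n : ℕ} {σ : Type} [MeasurableSpace σ] [Countable σ] [DiscreteMeasurableSpace σ]
  (M : ℕ → EpochMachine n σ)

/-- The configurations of all copies after a given history. -/
def configs : (t : ℕ) → PullHistory n t → ℕ → EpochConfig n σ
  | 0, _ => fun i => (M i).start (M i).init
  | t + 1, h =>
    Function.update (configs t fun k => h k.castSucc) (schedule t)
      ((M (schedule t)).step (configs t (fun k => h k.castSucc) (schedule t)) (h (Fin.last t)).2)

theorem measurable_configs (t i : ℕ) : Measurable fun h : PullHistory n t => configs M t h i := by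
  induction t generalizing i with
  | zero => exact measurable_const
  | succ t ih =>
    have hr : Measurable fun (h : PullHistory n (t + 1)) (k : Fin t) => h k.castSucc :=
      measurable_pi_iff.2 fun k => measurable_pi_apply _
    by_cases hi : i = schedule t
    · subst hi
      simp only [configs, Function.update_self]
      exact (M (schedule t)).measurable_step.comp (((ih _).comp hr).prodMk
        (measurable_snd.comp (measurable_pi_apply _)))
    · simp only [configs, Function.update_of_ne hi]
      exact (ih i).comp hr

theorem measurableSet_halted : MeasurableSet {c : EpochConfig n σ | c.1.2 = []} :=
  measurable_fst (MeasurableSet.of_discrete (s := {k : σ × List (Fin n) | k.2 = []}))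

/-- The bandit algorithm that runs the machines `M 0, M 1, …` in an interleaved way until one of
them halts, and then gives the answer of that machine. -/
def interleave : BanditAlgorithm n where
  Seed := Unit
  seedLaw := Measure.dirac ()
  isProb := inferInstance
  pull t p := (M (schedule t)).pull (configs M t p.2 (schedule t))
  measurable_pull t :=
    (M (schedule t)).measurable_pull.comp ((measurable_configs M t _).comp measurable_snd)
  stopRule t := {p | ∃ i, (configs M t p.2 i).1.2 = []}
  measurableSet_stopRule t := by
    have e : {p : Unit × PullHistory n t | ∃ i, (configs M t p.2 i).1.2 = []} =
        ⋃ i, (fun p : Unit × PullHistory n t => configs M t p.2 i) ⁻¹' {c | c.1.2 = []} := by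
      ext p; simp
    rw [e]
    exact .iUnion fun i => (measurable_configs M t i).comp measurable_snd measurableSet_halted
  answer t p :=
    open Classical in
    -- The second alternative only makes the search total; at a stopping time it is false, and the
    -- search returns the first halted copy.
    (fun i => (M i).out (configs M t p.2 i).1.1) (Nat.find
      (p := fun i => (configs M t p.2 i).1.2 = [] ∨ ¬ ∃ k, (configs M t p.2 k).1.2 = [])
      (by by_cases h : ∃ k, (configs M t p.2 k).1.2 = []
          · exact ⟨h.choose, Or.inl h.choose_spec⟩
          · exact ⟨0, Or.inr h⟩))
  measurable_answer t := by
    classical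
    have hh : ∀ i, MeasurableSet {p : Unit × PullHistory n t | (configs M t p.2 i).1.2 = []} :=
      fun i => (measurable_configs M t i).comp measurable_snd measurableSet_halted
    refine Measurable.find
      (f := fun i (p : Unit × PullHistory n t) => (M i).out (configs M t p.2 i).1.1) ?_ ?_ _
    · intro i
      exact (Measurable.of_discrete (f := (M i).out)).comp (measurable_fst.comp (measurable_fst.comp
        ((measurable_configs M t i).comp measurable_snd)))
    · intro i
      refine MeasurableSet.union (hh i) ?_
      have e : {p : Unit × PullHistory n t | ¬ ∃ k, (configs M t p.2 k).1.2 = []} =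
        ⋂ k, {p : Unit × PullHistory n t | (configs M t p.2 k).1.2 = []}ᶜ := by
        ext p; simp
      have h : MeasurableSet {p : Unit × PullHistory n t | ¬ ∃ k, (configs M t p.2 k).1.2 = []} := by
        rw [e]; exact MeasurableSet.iInter fun k => (hh k).compl
      exact h

/-- The configuration of the copy `i` after the first `t` rounds, on the table of rewards `x`. -/
def traj (x : ℕ → Fin n → ℝ) (t i : ℕ) : EpochConfig n σ :=
  configs M t ((interleave M).history () x t) i

theorem traj_zero (x : ℕ → Fin n → ℝ) (i : ℕ) : traj M x 0 i = (M i).start (M i).init := rfl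

theorem traj_succ (x : ℕ → Fin n → ℝ) (t i : ℕ) :
    traj M x (t + 1) i = if schedule t = i then
      (M i).step (traj M x t i) (x t ((M i).pull (traj M x t i))) else traj M x t i := by
  have e : (fun k : Fin t => (interleave M).history () x (t + 1) k.castSucc) =
      (interleave M).history () x t := by
    funext k
    simp only [BanditAlgorithm.history]
    exact Fin.snoc_castSucc (α := fun _ => Fin n × ℝ) _ _ _
  have e2 : (interleave M).history () x (t + 1) (Fin.last t) =
      ((interleave M).pull t ((), (interleave M).history () x t),
        x t ((interleave M).pull t ((), (interleave M).history () x t))) := by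
    simp only [BanditAlgorithm.history]
    exact Fin.snoc_last (α := fun _ => Fin n × ℝ) _ _
  unfold traj
  rw [configs, e, e2]
  by_cases h : schedule t = i
  · subst h
    simp [interleave]
  · rw [Function.update_of_ne (Ne.symm h), if_neg h]

/-- The first `t` rounds do not read row `t`. Together with the invariance of the reward law under
resampling that row, this yields the Markov property in `lintegral_traj`. -/
theorem traj_update (x : ℕ → Fin n → ℝ) (v : Fin n → ℝ) (s t i : ℕ) (hst : s ≤ t) :
    traj M (Function.update x t v) s i = traj M x s i := by
  induction s with
  | zero => rfl
  | succ s ih => rw [traj_succ, traj_succ, ih (by omega), Function.update_of_ne (by omega)]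

theorem measurable_traj (t i : ℕ) : Measurable fun x : ℕ → Fin n → ℝ => traj M x t i := by
  induction t with
  | zero => exact measurable_const
  | succ t ih =>
    simp_rw [traj_succ]
    by_cases h : schedule t = i
    · simp only [h, if_true]
      have hev : Measurable fun p : Fin n × (Fin n → ℝ) => p.2 p.1 :=
        measurable_from_prod_countable_right fun j => measurable_pi_apply j
      exact (M i).measurable_step.comp (ih.prodMk
        (hev.comp (((M i).measurable_pull.comp ih).prodMk (measurable_pi_apply t))))
    · simpa only [h, if_false] using ih

variable (I : BestArmInstance n)

/-- The copy `i`, observed at a fixed time, is a run of the machine `M i`. -/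
theorem lintegral_traj {φ : EpochConfig n σ → ℝ≥0∞} (hφ : Measurable φ) (t i : ℕ) :
    ∫⁻ x, φ (traj M x t i) ∂I.rewardLaw =
      ((M i).op I.law)^[Nat.count (fun t => schedule t = i) t] φ ((M i).start (M i).init) := by
  induction t generalizing φ with
  | zero => simp [traj_zero]
  | succ t ih =>
    rw [Nat.count_succ]
    by_cases h : schedule t = i
    · rw [if_pos h, Function.iterate_succ_apply, ← ih ((M i).measurable_op I.law hφ),
        I.lintegral_rewardLaw_update t (H := fun x => φ (traj M x (t + 1) i))
          (hφ.comp (measurable_traj M (t + 1) i))]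
      refine lintegral_congr fun x => ?_
      have hs : Measurable fun z => φ ((M i).step (traj M x t i) z) :=
        hφ.comp ((M i).measurable_step.comp (measurable_const.prodMk measurable_id))
      rw [op, ← I.lintegral_pi_law_eval _ hs]
      refine lintegral_congr fun v => ?_
      rw [traj_succ, if_pos h, traj_update M x v t t i le_rfl, Function.update_self]
    · rw [if_neg h, add_zero, ← ih hφ]
      simp_rw [traj_succ, if_neg h]

theorem traj_add_of_halted (x : ℕ → Fin n → ℝ) {t i : ℕ} (h : (traj M x t i).1.2 = []) (k : ℕ) :
    traj M x (t + k) i = traj M x t i := by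
  induction k with
  | zero => rfl
  | succ k ih =>
    rw [← add_assoc, traj_succ, ih]
    split_ifs
    · generalize traj M x t i = c at h ⊢
      obtain ⟨⟨s, w⟩, y⟩ := c
      subst h; rfl
    · rfl

/-- The configurations in which a machine has not halted with the answer `b`. -/
def unsuccessful (M : EpochMachine n σ) (b : Fin n) : Set (EpochConfig n σ) :=
  {c | ¬ (c.1.2 = [] ∧ M.out c.1.1 = b)}

/-- The configurations in which a machine has halted with an answer other than `b`. -/
def mistaken (M : EpochMachine n σ) (b : Fin n) : Set (EpochConfig n σ) :=
  {c | c.1.2 = [] ∧ M.out c.1.1 ≠ b}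

theorem measurableSet_unsuccessful (M : EpochMachine n σ) (b : Fin n) :
    MeasurableSet (M.unsuccessful b) :=
  measurable_fst (MeasurableSet.of_discrete
    (s := {k : σ × List (Fin n) | ¬ (k.2 = [] ∧ M.out k.1 = b)}))

theorem measurableSet_mistaken (M : EpochMachine n σ) (b : Fin n) :
    MeasurableSet (M.mistaken b) :=
  measurable_fst (MeasurableSet.of_discrete
    (s := {k : σ × List (Fin n) | k.2 = [] ∧ M.out k.1 ≠ b}))

theorem measure_traj_mem {E : Set (EpochConfig n σ)} (hE : MeasurableSet E) (t i : ℕ) :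
    I.rewardLaw {x | traj M x t i ∈ E} =
      ((M i).op I.law)^[Nat.count (fun t => schedule t = i) t] (E.indicator 1)
        ((M i).start (M i).init) := by
  rw [← lintegral_traj M I (measurable_one.indicator hE)]
  exact (lintegral_indicator_one (measurable_traj M t i hE)).symm

theorem runLaw_interleave_apply {E : Set (Unit × (ℕ → Fin n → ℝ))} :
    I.rewardLaw {x | ((), x) ∈ E} ≤ (interleave M).runLaw I E := by
  have e : (interleave M).runLaw I = I.rewardLaw.map (Prod.mk ()) := Measure.dirac_prod _
  rw [e]
  exact Measure.le_map_apply measurable_prodMk_left.aemeasurable E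

section bounds

variable {T : ℕ → ℕ} {f : ℕ → ℝ≥0∞}
  (hf : ∀ i N, T i ≤ N → ((M i).op I.law)^[N] (((M i).unsuccessful I.best).indicator 1)
    ((M i).start (M i).init) ≤ f i)

include hf

theorem measure_not_halted_le (i : ℕ) :
    I.rewardLaw {x | (traj M x (2 ^ (i + 1) * T i) i).1.2 ≠ []} ≤ f i := by
  refine le_trans (measure_mono ?_) ((measure_traj_mem M I
    (measurableSet_unsuccessful (M i) I.best) (2 ^ (i + 1) * T i) i).le.trans
      (hf i _ (le_count_schedule i _)))
  intro x hx h
  exact hx h.1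

/-- If `i + 1` is the first copy that halts on schedule, then copy `i` was late, which has
probability at most `f i`. So the cost of copy `i + 1` is weighted by the failure of copy `i` alone,
and no independence between the copies is needed. -/
theorem expectedSamples_interleave_le (hT : ∀ i, 1 ≤ T i) :
    (interleave M).expectedSamples I ≤
      2 * (T 0 : ℝ≥0∞) + ∑' i, 2 ^ (i + 2) * (T (i + 1) : ℝ≥0∞) * f i := by
  classical
  set B : ℕ → Set (ℕ → Fin n → ℝ) :=
    fun i => {x | (traj M x (2 ^ (i + 1) * T i) i).1.2 ≠ []} with hB
  have hBm : ∀ i, MeasurableSet (B i) := fun i =>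
    (measurable_traj M _ i measurableSet_halted).compl
  have hle : ∀ x i, x ∉ B i →
      (interleave M).numSamples ((), x) ≤ 2 ^ (i + 1) * (T i : ℝ≥0∞) := by
    intro x i hx
    have hx : (traj M x (2 ^ (i + 1) * T i) i).1.2 = [] := not_not.1 hx
    refine (iInf₂_le (2 ^ (i + 1) * T i) (show _ ∈ (interleave M).stopTimes ((), x) from
      ⟨i, hx⟩)).trans ?_
    push_cast
    exact le_rfl
  have hpt : ∀ x, (interleave M).numSamples ((), x) ≤
      2 * (T 0 : ℝ≥0∞) + ∑' i, (B i).indicator (fun _ => 2 ^ (i + 2) * (T (i + 1) : ℝ≥0∞)) x := by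
    intro x
    by_cases h : ∃ i, x ∉ B i
    · rcases hi : Nat.find h with _ | i
      · refine (hle x 0 ?_).trans ?_
        · exact hi ▸ Nat.find_spec h
        · simp
      · have h1 : x ∈ B i := not_not.1 (Nat.find_min h (by omega))
        refine (hle x (i + 1) (hi ▸ Nat.find_spec h)).trans (le_trans ?_ le_add_self)
        refine le_trans ?_ (ENNReal.le_tsum i)
        rw [Set.indicator_of_mem h1]
    · push Not at h
      -- If all copies are late, the series has infinitely many terms that are at least `1`, thanks
      -- to `1 ≤ T i`, so it also dominates an infinite number of samples.
      have : ∑' i, (B i).indicator (fun _ => 2 ^ (i + 2) * (T (i + 1) : ℝ≥0∞)) x = ⊤ := by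
        refine top_le_iff.1 ((ENNReal.tsum_const_eq_top_of_ne_zero (α := ℕ)
          one_ne_zero).symm.le.trans (ENNReal.tsum_le_tsum fun i => ?_))
        rw [Set.indicator_of_mem (h i)]
        have : 1 ≤ 2 ^ (i + 2) * T (i + 1) := Nat.one_le_iff_ne_zero.2
          (mul_ne_zero (by positivity) (by have := hT (i + 1); omega))
        exact_mod_cast this
      rw [this]; simp
  have e : (interleave M).runLaw I = I.rewardLaw.map (Prod.mk ()) := Measure.dirac_prod _
  unfold BanditAlgorithm.expectedSamples
  rw [e]
  refine (lintegral_map_le (μ := I.rewardLaw) (interleave M).numSamples (Prod.mk ())).trans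
    ((lintegral_mono hpt).trans ?_)
  rw [lintegral_add_left measurable_const, lintegral_tsum fun i =>
    (measurable_const.indicator (hBm i)).aemeasurable]
  refine add_le_add (by simp) (ENNReal.tsum_le_tsum fun i => ?_)
  rw [lintegral_indicator_const (hBm i)]
  exact mul_le_mul' le_rfl (measure_not_halted_le M I hf i)

/-- Since `f` tends to `0`, almost surely some copy halts. The answer can then be wrong only if some
copy halts with a wrong answer, and these events are summed. -/
theorem le_runLaw_interleave_returns {p : ℕ → ℝ≥0∞}
    (hf0 : Filter.Tendsto f Filter.atTop (nhds 0))
    (hp : ∀ i N, ((M i).op I.law)^[N] (((M i).mistaken I.best).indicator 1)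
      ((M i).start (M i).init) ≤ p i) :
    1 - ∑' i, p i ≤ (interleave M).runLaw I ((interleave M).returns I.best) := by
  classical
  set Z : Set (ℕ → Fin n → ℝ) := {x | ∀ i t, (traj M x t i).1.2 ≠ []} with hZ
  set E : ℕ → ℕ → Set (ℕ → Fin n → ℝ) :=
    fun i t => {x | traj M x t i ∈ (M i).mistaken I.best} with hE
  have hEm : ∀ i t, MeasurableSet (E i t) := fun i t =>
    measurable_traj M t i (measurableSet_mistaken (M i) I.best)
  have hE1 : ∀ i, I.rewardLaw (⋃ t, E i t) ≤ p i := by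
    intro i
    -- A halted copy never moves again, so the events increase in time, and the bound that is
    -- uniform in time passes to their union.
    have hmono : Monotone (E i) := by
      refine monotone_nat_of_le_succ fun t x hx => ?_
      have := traj_add_of_halted M x hx.1 1
      simp only [hE, Set.mem_ofPred_eq] at hx ⊢
      rwa [this]
    rw [hmono.measure_iUnion]
    exact iSup_le fun t => (measure_traj_mem M I (measurableSet_mistaken (M i) I.best) t i).le.trans
      (hp i _)
  have hZ0 : I.rewardLaw Z = 0 := by
    refine le_antisymm (ge_of_tendsto' hf0 fun i => ?_) zero_le
    refine le_trans (measure_mono ?_) (measure_not_halted_le M I hf i)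
    intro x hx
    exact hx i _
  have hsub : (Z ∪ ⋃ i, ⋃ t, E i t)ᶜ ⊆ {x | ((), x) ∈ (interleave M).returns I.best} := by
    intro x hx
    simp only [Set.mem_compl_iff, Set.mem_union, Set.mem_iUnion, not_or, not_exists] at hx
    obtain ⟨hx1, hx2⟩ := hx
    simp only [hZ, Set.mem_ofPred_eq, not_forall, not_not] at hx1
    obtain ⟨i, t, hit⟩ := hx1
    have hhalts : ∃ t, t ∈ (interleave M).stopTimes ((), x) := ⟨t, i, hit⟩
    refine ⟨Nat.find hhalts, ⟨Nat.find_spec hhalts, fun s hs => Nat.find_min' hhalts hs⟩, ?_⟩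
    obtain ⟨k, hk⟩ := Nat.find_spec hhalts
    set t0 := Nat.find hhalts
    have hex : ∃ i, (traj M x t0 i).1.2 = [] ∨ ¬ ∃ k, (traj M x t0 k).1.2 = [] := ⟨k, Or.inl hk⟩
    have h1 : (traj M x t0 (Nat.find hex)).1.2 = [] := by
      rcases Nat.find_spec hex with h | h
      · exact h
      · exact absurd ⟨k, hk⟩ h
    by_contra hne
    exact hx2 (Nat.find hex) t0 ⟨h1, hne⟩
  refine le_trans ?_ (runLaw_interleave_apply M I)
  refine le_trans ?_ (measure_mono hsub)
  have hU : MeasurableSet (Z ∪ ⋃ i, ⋃ t, E i t) := by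
    refine MeasurableSet.union ?_ (.iUnion fun i => .iUnion fun t => hEm i t)
    have : Z = ⋂ i, ⋂ t, {x | (traj M x t i).1.2 = []}ᶜ := by ext x; simp [hZ]
    rw [this]
    exact .iInter fun i => .iInter fun t => (measurable_traj M t i measurableSet_halted).compl
  rw [prob_compl_eq_one_sub hU]
  refine tsub_le_tsub_left ?_ 1
  refine (measure_union_le _ _).trans ?_
  rw [hZ0, zero_add]
  exact (measure_iUnion_le _).trans (ENNReal.tsum_le_tsum hE1)

end bounds

end EpochMachine

/-! ### Ranks and the upper half of a set of arms. -/

section rank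

variable {ι β : Type*} [LinearOrder β]

/-- For an injective key the ranks of the elements of `Q` are exactly `0, …, |Q| - 1`, each taken
once. -/
theorem card_filter_rank_lt {f : ι → β} (hf : Function.Injective f) (Q : Finset ι) {m : ℕ}
    (hm : m ≤ Q.card) :
    (Q.filter fun i => (Q.filter fun k => f i < f k).card < m).card = m := by
  classical
  set rk : ι → ℕ := fun i => (Q.filter fun k => f i < f k).card with hrk
  have hlt : ∀ i ∈ Q, ∀ k ∈ Q, f i < f k → rk k < rk i := by
    intro i _ k hk h
    refine Finset.card_lt_card ((Finset.ssubset_iff_of_subset ?_).2 ⟨k, ?_, ?_⟩)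
    · intro x hx
      simp only [Finset.mem_filter] at hx ⊢
      exact ⟨hx.1, h.trans hx.2⟩
    · simp [hk, h]
    · simp
  have hinj : Set.InjOn rk Q := by
    intro i hi k hk h
    by_contra hne
    rcases lt_or_gt_of_ne (hf.ne hne) with h' | h'
    · exact (hlt i hi k hk h').ne' h
    · exact (hlt k hk i hi h').ne h
  have himg : Q.image rk = Finset.range Q.card := by
    refine Finset.eq_of_subset_of_card_le ?_ ?_
    · intro x hx
      obtain ⟨i, hi, rfl⟩ := Finset.mem_image.1 hx
      rw [Finset.mem_range]
      exact Finset.card_lt_card ((Finset.ssubset_iff_of_subset (Finset.filter_subset _ _)).2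
        ⟨i, hi, by simp⟩)
    · rw [Finset.card_image_of_injOn hinj, Finset.card_range]
  rw [← Finset.card_image_of_injOn (hinj.mono (Finset.filter_subset _ _))]
  have : (Q.filter fun i => rk i < m).image rk = Finset.range m := by
    ext x
    simp only [Finset.mem_image, Finset.mem_filter, Finset.mem_range]
    constructor
    · rintro ⟨i, hi, rfl⟩; exact hi.2
    · intro hx
      have : x ∈ Q.image rk := by rw [himg, Finset.mem_range]; omega
      obtain ⟨i, hi, rfl⟩ := Finset.mem_image.1 this
      exact ⟨i, ⟨hi, hx⟩, rfl⟩
  rw [this, Finset.card_range]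

theorem lt_of_rank_lt {f : ι → β} {Q : Finset ι} {m : ℕ} {i k : ι}
    (hi : (Q.filter fun x => f i < f x).card < m)
    (hk : ¬ (Q.filter fun x => f k < f x).card < m) : f k < f i := by
  by_contra h
  refine hk (lt_of_le_of_lt (Finset.card_le_card fun x hx => ?_) hi)
  simp only [Finset.mem_filter] at hx ⊢
  exact ⟨hx.1, (not_lt.1 h).trans_lt hx.2⟩

end rank

/-- The upper half of a set of arms, where `P i k` says that the arm `k` is better than `i`, and
ties are broken in favour of the arm with the smaller index. -/
def upperHalf {n : ℕ} (Q : Finset (Fin n)) (P : Fin n → Fin n → Prop) : Finset (Fin n) :=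
  open Classical in
  Q.filter fun i => (Q.filter fun k => P i k ∨ (¬ P k i ∧ k < i)).card < Q.card / 2

section upperHalf

variable {n : ℕ} (Q : Finset (Fin n)) (a : Fin n → ℝ)

/-- Tie-breaking by index is comparison of an injective lexicographic key, to which the rank lemmas
apply. -/
theorem lex_lt_iff (i k : Fin n) :
    (toLex (a i, OrderDual.toDual i) < toLex (a k, OrderDual.toDual k)) ↔
      (a i < a k ∨ (¬ a k < a i ∧ k < i)) := by
  rw [Prod.Lex.toLex_lt_toLex]
  simp only [OrderDual.toDual_lt_toDual, not_lt]
  constructor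
  · rintro (h | ⟨h, h'⟩)
    · exact Or.inl h
    · exact Or.inr ⟨h.le, h'⟩
  · rintro (h | ⟨h, h'⟩)
    · exact Or.inl h
    · exact h.lt_or_eq.imp id fun h => ⟨h, h'⟩

theorem upperHalf_eq :
    upperHalf Q (fun i k => a i < a k) = open Classical in
      Q.filter fun i => (Q.filter fun k => toLex (a i, OrderDual.toDual i) <
        toLex (a k, OrderDual.toDual k)).card < Q.card / 2 := by
  unfold upperHalf
  simp only [lex_lt_iff]

theorem upperHalf_subset (P : Fin n → Fin n → Prop) : upperHalf Q P ⊆ Q :=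
  Finset.filter_subset _ _

theorem card_upperHalf : (upperHalf Q fun i k => a i < a k).card = Q.card / 2 := by
  rw [upperHalf_eq]
  refine Eq.trans (by congr!) (card_filter_rank_lt
    (f := fun i => toLex (a i, OrderDual.toDual i)) ?_ Q (Nat.div_le_self _ _))
  intro i k h
  simpa using congrArg (fun x => (ofLex x).2) h

theorem le_of_mem_upperHalf {i k : Fin n} (hi : i ∈ upperHalf Q fun i k => a i < a k)
    (hkQ : k ∈ Q) (hk : k ∉ upperHalf Q fun i k => a i < a k) : a k ≤ a i := by
  classical
  rw [upperHalf_eq] at hi hk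
  simp only [Finset.mem_filter, hkQ, true_and] at hi hk
  have h := lt_of_rank_lt (f := fun i => toLex (a i, OrderDual.toDual i)) (by convert hi.2)
    (by convert hk)
  rcases (lex_lt_iff a k i).1 h with h | h
  · exact h.le
  · exact not_lt.1 h.1

end upperHalf

/-! ### The elimination procedure. -/

/-- The states of the elimination procedure: the round `r`, the number `h` of earlier rounds with
eliminations, the number `j` of eliminations in this round, the stage `l` of the tournament, whether
an elimination has been decided, the set `S` of the surviving arms, and the set `Q` of the
survivors of the tournament among them. -/
structure ElimState (n : ℕ) : Type where
  r : ℕ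
  h : ℕ
  j : ℕ
  l : ℕ
  e : Bool
  S : Finset (Fin n)
  Q : Finset (Fin n)

instance {n : ℕ} : MeasurableSpace (ElimState n) := ⊤

instance {n : ℕ} : DiscreteMeasurableSpace (ElimState n) := ⟨fun _ => trivial⟩

instance {n : ℕ} : Countable (ElimState n) := by
  refine Function.Injective.countable
    (f := fun s : ElimState n => (s.r, s.h, s.j, s.l, s.e, s.S, s.Q)) ?_
  rintro ⟨⟩ ⟨⟩ h
  simpa using h

/-- The dyadic scale `2 ^ (-r)`. -/
def dyad (r : ℕ) : ℝ := ((2 : ℝ) ^ r)⁻¹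

namespace ElimState

variable {n : ℕ} (d : Fin n) (c : ℕ) (s : ElimState n)

/-- The accuracy of the round. -/
def eps : ℝ := dyad s.r

def pick (A : Finset (Fin n)) : Fin n := if h : A.Nonempty then A.min' h else d

/-- The winner of the tournament. -/
def winner : Fin n := pick d s.Q

/-- The first test takes place in every round, so its failure probabilities must be summable over
`r`. The later tests follow an elimination and can be counted by `h` and `j`. -/
def testLevel : ℕ := if s.j = 0 then c + 2 * Nat.clog 2 (s.r + 2) else c + s.h + s.j

/-- The number of pulls of each arm in the epoch with state `s`, for the confidence `exp (-c)`. -/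
def pulls (i : Fin n) : ℕ :=
  if s.S.card ≤ 1 then 0
  else if s.e then
    if i ∈ s.S then 512 * 4 ^ s.r * (c + s.h + s.j + 12) else 0
  else if 2 ≤ s.Q.card then
    if i ∈ s.Q then 8192 * 4 ^ s.r * ⌈((16 : ℝ) / 9) ^ s.l⌉₊ * (c + s.h + s.j + s.l + 12) else 0
  else if i ∈ s.S then
    -- The level is divided by `|S|`, since only the joint failure of more than a sixteenth of the
    -- estimates does harm. The winner enters all comparisons and gets the full level.
    128 * 4 ^ s.r * (12 + 16 * (s.testLevel c / s.S.card + 1) +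
      if i = s.winner d then s.testLevel c + 12 else 0)
  else 0

def plan : List (Fin n) := (List.finRange n).flatMap fun i => List.replicate (s.pulls d c i) i

/-- The margin by which empirical means are compared. -/
def margin : ℝ := if s.e then s.eps / 8 else if 2 ≤ s.Q.card then 0 else s.eps / 2

def average (y : Fin n → ℝ) (i : Fin n) : ℝ := y i / s.pulls d c i

def comparison (y : Fin n → ℝ) (i k : Fin n) : Prop :=
  s.average d c y i < s.average d c y k - s.margin

/-- The number of arms that are clearly worse than the winner of the tournament. -/
def worse (P : Fin n → Fin n → Prop) : ℕ :=
  open Classical in (s.S.filter fun i => P i (s.winner d)).card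

/-- The thresholds `3/8` and `1/4` differ by twice the tolerated `1/16` of wrong estimates. A round
that has begun to eliminate goes on until too few far arms are left to trigger a later first test by
themselves. -/
def decides (P : Fin n → Fin n → Prop) : Prop :=
  if s.j = 0 then 3 * s.S.card ≤ 8 * s.worse d P else s.S.card ≤ 4 * s.worse d P

def kept (P : Fin n → Fin n → Prop) : Finset (Fin n) :=
  open Classical in s.S.filter fun i => ¬ P i (s.winner d)

/-- The rewards enter only through a relation on the arms. Such relations form a finite discrete
space, so measurability of the transition reduces to that of the comparisons. -/
def succ (P : Fin n → Fin n → Prop) : ElimState n :=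
  open Classical in
  if s.e then ⟨s.r, s.h, s.j + 1, 0, false, s.kept d P, s.kept d P⟩
  else if 2 ≤ s.Q.card then ⟨s.r, s.h, s.j, s.l + 1, false, s.S, upperHalf s.Q P⟩
  else if s.decides d P then ⟨s.r, s.h, s.j, s.l, true, s.S, s.Q⟩
  else ⟨s.r + 1, if s.j = 0 then s.h else s.h + 1, 0, 0, false, s.S, s.S⟩

theorem count_plan (i : Fin n) : (s.plan d c).count i = s.pulls d c i := by
  classical
  unfold plan
  rw [List.count_flatMap]
  simp only [Function.comp_def, List.count_replicate]
  rw [← List.ofFn_eq_map, List.sum_ofFn]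
  simp

theorem length_plan : (s.plan d c).length = ∑ i, s.pulls d c i := by
  unfold plan
  rw [List.length_flatMap]
  simp only [List.length_replicate]
  rw [← List.ofFn_eq_map, List.sum_ofFn]

theorem plan_eq_nil_iff : s.plan d c = [] ↔ s.S.card ≤ 1 := by
  rw [← List.length_eq_zero_iff, length_plan, Finset.sum_eq_zero_iff]
  constructor
  · intro h
    by_contra hS
    have hS' : s.S.Nonempty := Finset.card_pos.1 (by omega)
    obtain ⟨i, hi⟩ := hS'
    by_cases he : s.e
    · have := h i (Finset.mem_univ _)
      simp [pulls, hS, he, hi] at this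
    · by_cases hQ : 2 ≤ s.Q.card
      · obtain ⟨k, hk⟩ := Finset.card_pos.1 (by omega : 0 < s.Q.card)
        have := h k (Finset.mem_univ _)
        simp [pulls, hS, he, hQ, hk] at this
        exact absurd this (not_le.2 (by positivity))
      · have := h i (Finset.mem_univ _)
        simp [pulls, hS, he, hQ, hi] at this
  · intro h i _
    simp [pulls, h]

theorem measurable_comparison : Measurable (s.comparison d c) := by
  refine measurable_pi_iff.2 fun i => measurable_pi_iff.2 fun k => ?_
  refine measurableSet_setOfPred.1 ?_
  unfold comparison average
  exact measurableSet_lt (by fun_prop) (by fun_prop)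

end ElimState

/-- The elimination procedure for the confidence `exp (-c)`. -/
def elimMachine {n : ℕ} (d : Fin n) (c : ℕ) : EpochMachine n (ElimState n) where
  init := ⟨0, 0, 0, 0, false, Finset.univ, Finset.univ⟩
  plan s := s.plan d c
  next s y := s.succ d (s.comparison d c y)
  measurable_next s := (Measurable.of_discrete (f := s.succ d)).comp (s.measurable_comparison d c)
  out s := ElimState.pick d s.S

/-! ### The best arm is rarely lost. -/

theorem exp_neg_add_le (c k : ℕ) :
    Real.exp (-((c + k : ℕ) : ℝ)) ≤ Real.exp (-c) * (1 / 2) ^ k := by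
  push_cast
  rw [neg_add, Real.exp_add]
  refine mul_le_mul_of_nonneg_left ?_ (Real.exp_nonneg _)
  have h : Real.exp (-1) ≤ 1 / 2 := by
    rw [Real.exp_neg, one_div]
    refine inv_anti₀ (by norm_num) ?_
    linarith [Real.exp_one_gt_d9]
  calc Real.exp (-(k : ℝ)) = Real.exp (-1) ^ k := by rw [← Real.exp_nat_mul]; ring_nf
    _ ≤ _ := pow_le_pow_left₀ (Real.exp_nonneg _) h _

theorem measure_union_le_ofReal {α : Type*} [MeasurableSpace α] {μ : Measure α} {A B : Set α}
    {p q : ℝ} (hp : 0 ≤ p) (hq : 0 ≤ q) (hA : μ A ≤ ENNReal.ofReal p)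
    (hB : μ B ≤ ENNReal.ofReal q) : μ (A ∪ B) ≤ ENNReal.ofReal (p + q) := by
  rw [ENNReal.ofReal_add hp hq]
  exact (measure_union_le _ _).trans (add_le_add hA hB)

namespace ElimState

variable {n : ℕ} (d : Fin n) (c : ℕ) (s : ElimState n) (I : BestArmInstance n)

/-- The arms of `A` with a large empirical mean, given the accuracy `a`. -/
def high (A : Finset (Fin n)) (a : ℝ) (y : Fin n → ℝ) : Finset (Fin n) :=
  open Classical in A.filter fun i => I.mean i + a ≤ s.average d c y i

/-- The arms of `A` with a small empirical mean, given the accuracy `a`. -/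
def low (A : Finset (Fin n)) (a : ℝ) (y : Fin n → ℝ) : Finset (Fin n) :=
  open Classical in A.filter fun i => s.average d c y i ≤ I.mean i - a

theorem measure_card_high_le (A : Finset (Fin n)) {a k : ℝ} {t : ℕ} (ha : 0 ≤ a)
    (hA : A.card ≤ 16 * t) (hk0 : 0 ≤ k) (hk : ∀ i ∈ A, k + 12 ≤ s.pulls d c i * a ^ 2 / 2) :
    epochLaw I.law (s.plan d c) {y | t ≤ (s.high d c I A a y).card} ≤
      ENNReal.ofReal (Real.exp (-(t * k))) := by
  refine le_trans (measure_mono fun y hy => ?_) (I.measure_card_deviants_le (s.plan d c) A (ς := 1)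
    (by norm_num) ha hA (by simpa only [count_plan] using hk))
  refine le_trans (show t ≤ _ from hy) (Finset.card_le_card fun i hi => ?_)
  simp only [high, BestArmInstance.deviants, Finset.mem_filter, count_plan] at hi ⊢
  refine ⟨hi.1, ?_⟩
  have h1 : (0 : ℝ) < s.pulls d c i := by
    rcases (Nat.cast_nonneg (α := ℝ) (s.pulls d c i)).eq_or_lt with h | h
    · have := hk i hi.1
      rw [← h] at this; linarith
    · exact h
  have h2 := hi.2
  rw [average, le_div_iff₀ h1] at h2
  linarith

theorem measure_card_low_le (A : Finset (Fin n)) {a k : ℝ} {t : ℕ} (ha : 0 ≤ a)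
    (hA : A.card ≤ 16 * t) (hk0 : 0 ≤ k) (hk : ∀ i ∈ A, k + 12 ≤ s.pulls d c i * a ^ 2 / 2) :
    epochLaw I.law (s.plan d c) {y | t ≤ (s.low d c I A a y).card} ≤
      ENNReal.ofReal (Real.exp (-(t * k))) := by
  refine le_trans (measure_mono fun y hy => ?_) (I.measure_card_deviants_le (s.plan d c) A
    (ς := -1) (by norm_num) ha hA (by simpa only [count_plan] using hk))
  refine le_trans (show t ≤ _ from hy) (Finset.card_le_card fun i hi => ?_)
  simp only [low, BestArmInstance.deviants, Finset.mem_filter, count_plan] at hi ⊢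
  refine ⟨hi.1, ?_⟩
  have h1 : (0 : ℝ) < s.pulls d c i := by
    rcases (Nat.cast_nonneg (α := ℝ) (s.pulls d c i)).eq_or_lt with h | h
    · have := hk i hi.1
      rw [← h] at this; linarith
    · exact h
  have h2 := hi.2
  rw [average, div_le_iff₀ h1] at h2
  linarith

theorem measure_high_le (i : Fin n) {a k : ℝ} (ha : 0 ≤ a) (hk0 : 0 ≤ k)
    (hk : k + 12 ≤ s.pulls d c i * a ^ 2 / 2) :
    epochLaw I.law (s.plan d c) {y | I.mean i + a ≤ s.average d c y i} ≤
      ENNReal.ofReal (Real.exp (-k)) := by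
  refine le_trans (measure_mono fun y hy => ?_) (s.measure_card_high_le d c I {i} (t := 1) ha
    (by simp) hk0 (by simpa using hk)) |>.trans (by simp)
  exact Finset.card_pos.2 ⟨i, by simpa [high] using hy⟩

theorem measure_low_le (i : Fin n) {a k : ℝ} (ha : 0 ≤ a) (hk0 : 0 ≤ k)
    (hk : k + 12 ≤ s.pulls d c i * a ^ 2 / 2) :
    epochLaw I.law (s.plan d c) {y | s.average d c y i ≤ I.mean i - a} ≤
      ENNReal.ofReal (Real.exp (-k)) := by
  refine le_trans (measure_mono fun y hy => ?_) (s.measure_card_low_le d c I {i} (t := 1) ha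
    (by simp) hk0 (by simpa using hk)) |>.trans (by simp)
  exact Finset.card_pos.2 ⟨i, by simpa [low] using hy⟩

theorem eps_pos : 0 < s.eps := by unfold eps dyad; positivity

theorem four_pow_mul_eps_sq : (4 : ℝ) ^ s.r * s.eps ^ 2 = 1 := by
  unfold eps dyad
  rw [inv_pow, ← pow_mul, mul_comm s.r 2, pow_mul]
  norm_num

theorem pick_mem {A : Finset (Fin n)} (h : A.Nonempty) : pick d A ∈ A := by
  rw [pick, dif_pos h]; exact A.min'_mem h

theorem pulls_of_elim (hS : 2 ≤ s.S.card) (he : s.e = true) {i : Fin n} (hi : i ∈ s.S) :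
    s.pulls d c i = 512 * 4 ^ s.r * (c + s.h + s.j + 12) := by
  simp [pulls, show ¬ s.S.card ≤ 1 by omega, he, hi]

theorem pulls_accuracy_of_elim (hS : 2 ≤ s.S.card) (he : s.e = true) {i : Fin n} (hi : i ∈ s.S) :
    ((c + (s.h + s.j) : ℕ) : ℝ) + 12 ≤ s.pulls d c i * (s.eps / 16) ^ 2 / 2 := by
  rw [s.pulls_of_elim d c hS he hi]
  have := s.four_pow_mul_eps_sq
  push_cast
  refine le_of_eq ?_
  linear_combination -(c + s.h + s.j + 12 : ℝ) * this

/-- The margin `ε / 8` covers two errors of `ε / 16`, and no winner has a larger mean than the best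
arm. The quality of the winner does not matter. -/
theorem best_mem_kept (hb : I.best ∈ s.S) (he : s.e = true) {y : Fin n → ℝ}
    (h1 : s.average d c y (s.winner d) < I.mean (s.winner d) + s.eps / 16)
    (h2 : I.mean I.best - s.eps / 16 < s.average d c y I.best) :
    I.best ∈ s.kept d (s.comparison d c y) := by
  have h3 : I.mean (s.winner d) ≤ I.mean I.best := by
    by_cases h : s.winner d = I.best
    · rw [h]
    · exact (I.mean_lt_mean_best h).le
  simp only [kept, Finset.mem_filter, hb, true_and, comparison, margin, he, if_true, not_lt]
  linarith

/-- The invariant that the best arm survives. -/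
structure Sound : Prop where
  best_mem : I.best ∈ s.S
  subset : s.Q ⊆ s.S
  nonempty : s.Q.Nonempty

variable {s I}

theorem Sound.winner_mem (hs : s.Sound I) : s.winner d ∈ s.S :=
  hs.subset (pick_mem d hs.nonempty)

theorem Sound.succ (hs : s.Sound I) {P : Fin n → Fin n → Prop}
    (h : s.e = true → I.best ∈ s.kept d P)
    (h' : s.e = false → 2 ≤ s.Q.card → (upperHalf s.Q P).Nonempty) :
    (s.succ d P).Sound I := by
  unfold ElimState.succ
  split_ifs with he hQ hd
  · exact ⟨h he, subset_rfl, ⟨_, h he⟩⟩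
  · exact ⟨hs.best_mem, (upperHalf_subset _ _).trans hs.subset, h' (by simpa using he) hQ⟩
  · exact ⟨hs.best_mem, hs.subset, hs.nonempty⟩
  all_goals exact ⟨hs.best_mem, subset_rfl, ⟨_, hs.best_mem⟩⟩

theorem upperHalf_comparison (he : s.e = false) (hQ : 2 ≤ s.Q.card) (y : Fin n → ℝ) :
    s.comparison d c y = fun i k => s.average d c y i < s.average d c y k := by
  funext i k
  simp [comparison, margin, he, hQ]

theorem upperHalf_nonempty (he : s.e = false) (hQ : 2 ≤ s.Q.card) (y : Fin n → ℝ) :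
    (upperHalf s.Q (s.comparison d c y)).Nonempty := by
  rw [upperHalf_comparison d c he hQ, ← Finset.card_pos, card_upperHalf]
  omega

theorem pick_eq_best (hs : s.Sound I) (h : s.S.card ≤ 1) : pick d s.S = I.best :=
  Finset.card_le_one.1 h _ (pick_mem d ⟨_, hs.best_mem⟩) _ hs.best_mem

/-- The potential for the probability that the best arm is lost. -/
def lossBound (s : ElimState n) : ℝ :=
  Real.exp (-c) * (4 * (1 / 2) ^ (s.h + s.j) + 4 * (1 / 2) ^ s.h)

theorem lossBound_nonneg (s : ElimState n) : 0 ≤ s.lossBound c := by unfold lossBound; positivity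

/-- When a round with eliminations ends, `h` grows by one, and the reserve `4 * (1 / 2) ^ h` splits
into the two equal summands of the next state. -/
theorem lossBound_succ_le (s : ElimState n) (he : s.e = false) (P : Fin n → Fin n → Prop) :
    (s.succ d P).lossBound c ≤ s.lossBound c := by
  unfold succ lossBound
  split_ifs with h1 h2 h3 h4
  · simp [he] at h1
  · exact le_rfl
  · exact le_rfl
  · simp only [h4]; exact le_rfl
  · refine mul_le_mul_of_nonneg_left ?_ (Real.exp_nonneg _)
    simp only [add_zero, pow_succ]
    have : (0 : ℝ) ≤ (1 / 2) ^ (s.h + s.j) := by positivity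
    linarith

end ElimState

open ElimState in
/-- The elimination procedure rarely halts with a wrong answer. -/
theorem iterate_op_mistaken_le {n : ℕ} (I : BestArmInstance n) (d : Fin n) (c N : ℕ) :
    ((elimMachine d c).op I.law)^[N] (((elimMachine d c).mistaken I.best).indicator 1)
      ((elimMachine d c).start (elimMachine d c).init) ≤ ENNReal.ofReal (8 * Real.exp (-c)) := by
  classical
  have key := (elimMachine d c).iterate_op_start_le_of_invariant I.law
    (φ := ((elimMachine d c).mistaken I.best).indicator 1)
    (measurable_one.indicator (EpochMachine.measurableSet_mistaken _ _))
    (fun x => Set.indicator_le_self' (by simp) x)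
    (fun s w y hw => Set.indicator_of_notMem (fun h => hw h.1) _)
    (fun s => s.Sound I) (lossBound c) ?_ ?_ N (elimMachine d c).init
    ⟨Finset.mem_univ _, subset_rfl, ⟨d, Finset.mem_univ _⟩⟩
  · refine key.trans (ENNReal.ofReal_le_ofReal (le_of_eq ?_))
    simp [elimMachine, lossBound]; ring
  · intro s hs hplan
    have hS : s.S.card ≤ 1 := (s.plan_eq_nil_iff d c).1 hplan
    exact Set.indicator_of_notMem (fun h => h.2 (pick_eq_best d hs hS)) _
  · intro s hs hplan
    have hS : 2 ≤ s.S.card := by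
      have := mt (s.plan_eq_nil_iff d c).2 hplan; omega
    by_cases he : s.e = true
    · refine ⟨({y | I.mean (s.winner d) + s.eps / 16 ≤ s.average d c y (s.winner d)} ∪
        {y | s.average d c y I.best ≤ I.mean I.best - s.eps / 16})ᶜ,
        Real.exp (-((c + (s.h + s.j) : ℕ) : ℝ)) + Real.exp (-((c + (s.h + s.j) : ℕ) : ℝ)),
        -- The two possible misestimates use up half of the first summand; the other half is the
        -- first summand for `j + 1`.
        Real.exp (-c) * (2 * (1 / 2) ^ (s.h + s.j) + 4 * (1 / 2) ^ s.h), by positivity,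
        by positivity, ?_, ?_, ?_⟩
      · rw [compl_compl]
        have ha : 0 ≤ s.eps / 16 := by have := s.eps_pos; positivity
        exact measure_union_le_ofReal (Real.exp_nonneg _) (Real.exp_nonneg _)
          (s.measure_high_le d c I _ ha (Nat.cast_nonneg _)
            (s.pulls_accuracy_of_elim d c hS he (hs.winner_mem d)))
          (s.measure_low_le d c I _ ha (Nat.cast_nonneg _)
            (s.pulls_accuracy_of_elim d c hS he hs.best_mem))
      · have := exp_neg_add_le c (s.h + s.j)
        unfold lossBound
        linarith
      · intro y hy
        simp only [Set.mem_compl_iff, Set.mem_union, Set.mem_ofPred_eq, not_or, not_le] at hy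
        refine ⟨hs.succ d (fun _ => s.best_mem_kept d c I hs.best_mem he hy.1 hy.2) (by simp [he]),
          le_of_eq ?_⟩
        simp only [elimMachine, succ, he, if_true, lossBound, ← add_assoc, pow_succ]
        ring
    · have he : s.e = false := by simpa using he
      refine ⟨Set.univ, 0, lossBound c s, le_rfl, lossBound_nonneg c s, by simp, by simp,
        fun y _ => ⟨hs.succ d (by simp [he]) fun _ hQ => upperHalf_nonempty d c he hQ y,
          lossBound_succ_le d c s he _⟩⟩

/-! ### Dyadic gap classes and the count of rounds with eliminations. -/

theorem dyad_pos (r : ℕ) : 0 < dyad r := by unfold dyad; positivity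

theorem dyad_zero : dyad 0 = 1 := by simp [dyad]

theorem dyad_succ (r : ℕ) : dyad (r + 1) = dyad r / 2 := by
  unfold dyad; rw [pow_succ, mul_inv]; ring

theorem dyad_lt_dyad_iff {r s : ℕ} : dyad r < dyad s ↔ s < r := by
  unfold dyad
  rw [inv_lt_inv₀ (by positivity) (by positivity)]
  exact pow_lt_pow_iff_right₀ (by norm_num)

theorem zpow_neg_eq_dyad (s : ℕ) : (2 : ℝ) ^ (-(s : ℤ)) = dyad s := by
  rw [zpow_neg, zpow_natCast, dyad]

namespace BestArmInstance

variable {n : ℕ} (I : BestArmInstance n)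

theorem gap_best : I.gap I.best = 0 := sub_self _

theorem gap_pos {i : Fin n} (hi : i ≠ I.best) : 0 < I.gap i := sub_pos.2 (I.mean_lt_mean_best hi)

theorem gap_nonneg (i : Fin n) : 0 ≤ I.gap i := by
  by_cases h : i = I.best
  · rw [h, gap_best]
  · exact (I.gap_pos h).le

theorem gap_le_one (i : Fin n) : I.gap i ≤ 1 := by
  have h1 := (I.mean_mem I.best).2
  have h2 := (I.mean_mem i).1
  unfold gap mean
  linarith

theorem exists_dyad_le_gap {i : Fin n} (hi : i ≠ I.best) : ∃ s, dyad s ≤ I.gap i := by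
  obtain ⟨s, hs⟩ := exists_pow_lt_of_lt_one (I.gap_pos hi) (by norm_num : (1 / 2 : ℝ) < 1)
  refine ⟨s, ?_⟩
  rw [dyad, ← inv_pow, ← one_div]
  exact hs.le

/-- The index of the dyadic gap class of an arm other than the best one. -/
def gapIndex (i : Fin n) : ℕ :=
  open Classical in if h : ∃ s, dyad s ≤ I.gap i then Nat.find h else 0

theorem dyad_gapIndex_le {i : Fin n} (hi : i ≠ I.best) : dyad (I.gapIndex i) ≤ I.gap i := by
  classical
  rw [gapIndex, dif_pos (I.exists_dyad_le_gap hi)]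
  exact Nat.find_spec (I.exists_dyad_le_gap hi)

theorem gap_lt_two_mul_dyad {i : Fin n} (hi : i ≠ I.best) :
    I.gap i < 2 * dyad (I.gapIndex i) := by
  classical
  have h := I.exists_dyad_le_gap hi
  rw [gapIndex, dif_pos h]
  rcases hs : Nat.find h with _ | s
  · rw [dyad_zero]; linarith [I.gap_le_one i]
  · have := Nat.find_min h (m := s) (by omega)
    rw [dyad_succ]; linarith

/-- The indices of the nonempty dyadic gap classes. -/
def classes : Finset ℕ := (Finset.univ.erase I.best).image I.gapIndex

theorem gapIndex_mem_classes {i : Fin n} (hi : i ≠ I.best) : I.gapIndex i ∈ I.classes :=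
  Finset.mem_image_of_mem _ (Finset.mem_erase.2 ⟨hi, Finset.mem_univ _⟩)

/-- The additional class has index `0` and consists of the arms with gap exactly `1`. -/
theorem card_classes_le {K : ℕ} (h : I.numClasses ≤ K) : I.classes.card ≤ K + 1 := by
  have h1 : ((I.classes.erase 0 : Finset ℕ) : Set ℕ) ⊆
      {s : ℕ | 1 ≤ s ∧ (I.gapClass s).Nonempty} := by
    intro s hs
    simp only [Finset.coe_erase, Set.mem_sdiff, Finset.mem_coe, Set.mem_singleton_iff] at hs
    obtain ⟨i, hi, rfl⟩ := Finset.mem_image.1 hs.1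
    have hi := (Finset.mem_erase.1 hi).1
    refine ⟨Nat.one_le_iff_ne_zero.2 hs.2, i, ?_, ?_⟩
    · rw [zpow_neg_eq_dyad]; exact I.dyad_gapIndex_le hi
    · rw [zpow_add₀ (by norm_num), zpow_neg_eq_dyad, zpow_one, mul_comm]
      exact I.gap_lt_two_mul_dyad hi
  have h2 := (Set.encard_le_encard h1).trans h
  rw [Set.encard_coe_eq_coe_finsetCard] at h2
  have h3 : (I.classes.erase 0).card ≤ K := by exact_mod_cast h2
  have := Finset.pred_card_le_card_erase (s := I.classes) (a := 0)
  omega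

/-- The arms of `S` with a gap of at least `x`. -/
def far (x : ℝ) (S : Finset (Fin n)) : Finset (Fin n) :=
  open Classical in S.filter fun i => x ≤ I.gap i

theorem mem_far {x : ℝ} {S : Finset (Fin n)} {i : Fin n} :
    i ∈ I.far x S ↔ i ∈ S ∧ x ≤ I.gap i := by simp [far]

/-- No gap lies in `[2 ^ (-r), 2 ^ (-r + 1))`. Hence such a round has no new arms to eliminate, and
its first tournament need not succeed. -/
theorem far_eq_of_notMem_classes {r : ℕ} (hr : r ∉ I.classes) (S : Finset (Fin n)) :
    I.far (dyad r) S = I.far (2 * dyad r) S := by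
  ext i
  simp only [mem_far]
  refine and_congr_right fun _ => ⟨fun h => ?_, fun h => by linarith [dyad_pos r]⟩
  by_contra hlt
  rw [not_le] at hlt
  have hi : i ≠ I.best := by
    rintro rfl
    rw [gap_best] at h; exact absurd (dyad_pos r) h.not_gt
  have h1 := I.dyad_gapIndex_le hi
  have h2 := I.gap_lt_two_mul_dyad hi
  have h3 : I.gapIndex i < r + 1 := by
    rw [← dyad_lt_dyad_iff, dyad_succ]; linarith
  have h4 : r < I.gapIndex i + 1 := by
    rw [← dyad_lt_dyad_iff, dyad_succ]; linarith
  exact hr ((by omega : I.gapIndex i = r) ▸ I.gapIndex_mem_classes hi)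

/-- A bound for the number of rounds up to `r` in which arms are eliminated. -/
def elimCount (r : ℕ) : ℕ := ∑ s ∈ I.classes, min 3 (r + 3 - s)

theorem elimCount_le (r : ℕ) : I.elimCount r ≤ 3 * I.classes.card := by
  unfold elimCount
  refine (Finset.sum_le_card_nsmul _ _ 3 fun s _ => min_le_left _ _).trans ?_
  rw [smul_eq_mul, mul_comm]

/-- The index `s` of the arm satisfies `ρ < s ≤ r + 2`, and the summand of `s` grows strictly from
`ρ` to `r`. The cap `3` reflects that an arm can prompt an elimination up to two rounds before the
round of its own class. -/
theorem elimCount_lt {ρ r : ℕ} (hr : ρ < r) {i : Fin n} (h1 : dyad r / 4 < I.gap i)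
    (h2 : I.gap i < dyad ρ) : I.elimCount ρ + 1 ≤ I.elimCount r := by
  have hi : i ≠ I.best := by
    rintro rfl
    rw [gap_best] at h1; linarith [dyad_pos r]
  have h3 := I.dyad_gapIndex_le hi
  have h4 := I.gap_lt_two_mul_dyad hi
  have h5 : ρ < I.gapIndex i := by rw [← dyad_lt_dyad_iff]; linarith
  have h6 : I.gapIndex i < r + 3 := by
    rw [← dyad_lt_dyad_iff, dyad_succ, dyad_succ, dyad_succ]; linarith
  refine Nat.succ_le_of_lt (Finset.sum_lt_sum (fun s _ => ?_)
    ⟨_, I.gapIndex_mem_classes hi, ?_⟩) <;> omega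

end BestArmInstance

/-! ### The invariant of runs without relevant failures. -/

namespace ElimState

variable {n : ℕ} (d : Fin n) (c : ℕ) (s : ElimState n) (I : BestArmInstance n)

/-- The arms that are clearly worse than the winner of the tournament. -/
def inferior : Finset (Fin n) :=
  open Classical in s.S.filter fun i => I.mean i < I.mean (s.winner d) - s.eps / 4

/-- The invariant of the runs in which no relevant estimate fails. -/
structure Healthy : Prop extends s.Sound I where
  far_le : s.e = false → s.j = 0 → 16 * (I.far (2 * s.eps) s.S).card ≤ 7 * s.S.card
  count : s.e = false → s.j = 0 → s.h = 0 ∨ ∃ ρ < s.r, s.h ≤ I.elimCount ρ + 1 ∧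
    16 * (I.far (dyad ρ) s.S).card < 5 * s.S.card
  count' : s.e = true ∨ s.j ≠ 0 → s.h ≤ I.elimCount s.r
  exists_near : s.r ∈ I.classes ∨ s.j ≠ 0 →
    ∃ i ∈ s.Q, I.gap i ≤ s.eps / 8 * (1 - (3 / 4) ^ s.l)
  card_inferior : s.e = true → 3 * s.S.card ≤ 16 * (s.inferior d I).card

theorem gap_winner_le (hQ : ¬ 2 ≤ s.Q.card)
    (h : ∃ i ∈ s.Q, I.gap i ≤ s.eps / 8 * (1 - (3 / 4) ^ s.l)) :
    I.gap (s.winner d) ≤ s.eps / 8 := by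
  obtain ⟨i, hi, h⟩ := h
  have : s.winner d = i :=
    Finset.card_le_one.1 (by omega) _ (pick_mem d ⟨i, hi⟩) _ hi
  rw [this]
  refine h.trans ?_
  have h1 : (0 : ℝ) ≤ (3 / 4) ^ s.l := by positivity
  nlinarith [s.eps_pos]

theorem gap_sub_gap (i k : Fin n) : I.gap i - I.gap k = I.mean k - I.mean i := by
  unfold BestArmInstance.gap; ring

/-- The tournament keeps an arm that is almost as good as a given one. -/
theorem exists_mem_upperHalf (he : s.e = false) (hQ : 2 ≤ s.Q.card) {y : Fin n → ℝ} {a : ℝ}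
    (ha : 0 ≤ a) {x : Fin n} (hx : x ∈ s.Q) (h1 : (s.high d c I s.Q a y).card < s.Q.card / 2)
    (h2 : I.mean x - a < s.average d c y x) :
    ∃ i ∈ upperHalf s.Q (s.comparison d c y), I.gap i ≤ I.gap x + 2 * a := by
  classical
  by_contra! hcon
  rw [upperHalf_comparison d c he hQ] at hcon
  have hx' : x ∉ upperHalf s.Q fun i k => s.average d c y i < s.average d c y k :=
    fun h => by linarith [hcon x h]
  refine absurd (Finset.card_le_card (s := upperHalf s.Q
    fun i k => s.average d c y i < s.average d c y k) (t := s.high d c I s.Q a y) fun i hi => ?_)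
    (not_le.2 (by rw [card_upperHalf]; exact h1))
  have h3 := hcon i hi
  have h4 := gap_sub_gap I i x
  have h5 := le_of_mem_upperHalf s.Q _ hi hx hx'
  simp only [high, Finset.mem_filter]
  exact ⟨upperHalf_subset _ _ hi, by linarith⟩

/-- A far arm is at least `7ε/8` below the winner. Two errors of `ε/8` leave `5ε/8`, more than the
margin `ε/2`. -/
theorem card_far_le_worse_add (he : s.e = false) (hQ : ¬ 2 ≤ s.Q.card) {y : Fin n → ℝ}
    (hgap : I.gap (s.winner d) ≤ s.eps / 8)
    (hw : I.mean (s.winner d) - s.eps / 8 < s.average d c y (s.winner d)) :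
    (I.far s.eps s.S).card ≤
      s.worse d (s.comparison d c y) + (s.high d c I s.S (s.eps / 8) y).card := by
  classical
  refine (Finset.card_le_card fun i hi => ?_).trans (Finset.card_union_le _ _)
  obtain ⟨hiS, hi⟩ := I.mem_far.1 hi
  simp only [Finset.mem_union, Finset.mem_filter, high, hiS, true_and, comparison, margin, he, hQ,
    if_false, Bool.false_eq_true]
  by_contra! hcon
  have := gap_sub_gap I i (s.winner d)
  linarith [hcon.1, hcon.2, s.eps_pos]

/-- Two errors of `ε/8` reduce the margin `ε/2` to `ε/4`. This direction holds for any winner, so a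
positive test is sound even after a failed tournament. -/
theorem worse_le_card_inferior_add (he : s.e = false) (hQ : ¬ 2 ≤ s.Q.card) {y : Fin n → ℝ}
    (hw : s.average d c y (s.winner d) < I.mean (s.winner d) + s.eps / 8) :
    s.worse d (s.comparison d c y) ≤
      (s.inferior d I).card + (s.low d c I s.S (s.eps / 8) y).card := by
  classical
  refine (Finset.card_le_card fun i hi => ?_).trans (Finset.card_union_le _ _)
  simp only [Finset.mem_filter, comparison, margin, he, hQ, if_false, Bool.false_eq_true] at hi
  simp only [Finset.mem_union, Finset.mem_filter, low, inferior, hi.1, true_and]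
  by_contra! hcon
  linarith

/-- An inferior arm is `ε/4` below the winner; after two errors of `ε/16` the margin `ε/8` is still
exceeded. -/
theorem card_kept_add_le (he : s.e = true) {y : Fin n → ℝ}
    (hw : I.mean (s.winner d) - s.eps / 16 < s.average d c y (s.winner d)) :
    (s.kept d (s.comparison d c y)).card + (s.inferior d I).card ≤
      s.S.card + (s.high d c I s.S (s.eps / 16) y).card := by
  classical
  have h1 : s.kept d (s.comparison d c y) ⊆
      (s.S \ s.inferior d I) ∪ s.high d c I s.S (s.eps / 16) y := by
    intro i hi
    simp only [kept, Finset.mem_filter, comparison, margin, he, if_true] at hi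
    simp only [Finset.mem_union, Finset.mem_sdiff, Finset.mem_filter, high, inferior, hi.1,
      true_and]
    by_contra! hcon
    linarith [hi.2]
  have h2 := (Finset.card_le_card h1).trans (Finset.card_union_le _ _)
  have h3 := Finset.card_sdiff_add_card_eq_card
    (Finset.filter_subset (fun i => I.mean i < I.mean (s.winner d) - s.eps / 4) s.S)
  unfold inferior at h2 ⊢
  omega

end ElimState

namespace ElimState

variable {n : ℕ} {d : Fin n} {c : ℕ} {s : ElimState n} {I : BestArmInstance n}
  {P : Fin n → Fin n → Prop} {y : Fin n → ℝ}

theorem succ_of_elim (he : s.e = true) :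
    s.succ d P = ⟨s.r, s.h, s.j + 1, 0, false, s.kept d P, s.kept d P⟩ := by
  simp [succ, he]

theorem succ_of_tournament (he : s.e = false) (hQ : 2 ≤ s.Q.card) :
    s.succ d P = ⟨s.r, s.h, s.j, s.l + 1, false, s.S, upperHalf s.Q P⟩ := by
  simp [succ, he, hQ]

theorem succ_of_decides (he : s.e = false) (hQ : ¬ 2 ≤ s.Q.card) (hP : s.decides d P) :
    s.succ d P = ⟨s.r, s.h, s.j, s.l, true, s.S, s.Q⟩ := by
  simp [succ, he, hQ, hP]

theorem succ_of_not_decides (he : s.e = false) (hQ : ¬ 2 ≤ s.Q.card) (hP : ¬ s.decides d P) :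
    s.succ d P = ⟨s.r + 1, if s.j = 0 then s.h else s.h + 1, 0, 0, false, s.S, s.S⟩ := by
  simp [succ, he, hQ, hP]

theorem Healthy.succ_tournament (hs : s.Healthy d I) (he : s.e = false) (hQ : 2 ≤ s.Q.card)
    (h : s.r ∈ I.classes ∨ s.j ≠ 0 → ∃ i ∈ upperHalf s.Q (s.comparison d c y),
      I.gap i ≤ s.eps / 8 * (1 - (3 / 4) ^ (s.l + 1))) :
    (s.succ d (s.comparison d c y)).Healthy d I := by
  refine ⟨hs.toSound.succ d (by simp [he]) fun _ hQ => upperHalf_nonempty d c he hQ y,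
    ?_, ?_, ?_, ?_, ?_⟩ <;> rw [succ_of_tournament he hQ]
  · exact fun _ => hs.far_le he
  · exact fun _ => hs.count he
  · exact fun h => hs.count' (Or.inr (by simpa using h))
  · exact h
  · simp

theorem gap_of_mem_inferior {i : Fin n} (hi : i ∈ s.inferior d I) : s.eps / 4 < I.gap i := by
  simp only [inferior, Finset.mem_filter] at hi
  have h1 := I.gap_nonneg (s.winner d)
  have h2 := gap_sub_gap I i (s.winner d)
  linarith [hi.2]

theorem Healthy.succ_decides (hs : s.Healthy d I) (he : s.e = false) (hQ : ¬ 2 ≤ s.Q.card)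
    (hw : s.average d c y (s.winner d) < I.mean (s.winner d) + s.eps / 8)
    (hlow : 16 * (s.low d c I s.S (s.eps / 8) y).card ≤ s.S.card)
    (hP : s.decides d (s.comparison d c y)) :
    (s.succ d (s.comparison d c y)).Healthy d I := by
  have h1 := s.worse_le_card_inferior_add d c I he hQ hw
  have h2 : 3 * s.S.card ≤ 16 * (s.inferior d I).card := by
    unfold decides at hP
    split_ifs at hP <;> omega
  refine ⟨hs.toSound.succ d (by simp [he]) fun _ hQ' => absurd hQ' hQ,
    ?_, ?_, ?_, ?_, ?_⟩ <;> rw [succ_of_decides he hQ hP]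
  · simp
  · simp
  · intro _
    by_cases hj : s.j = 0
    · rcases hs.count he hj with h | ⟨ρ, hρ, hh, hfar⟩
      · exact h ▸ Nat.zero_le _
      -- The first test leaves at least `6/16 - 1/16` of `S` inferior, while fewer than `5/16` have
      -- gap at least `2 ^ (-ρ)`. So some inferior arm was not yet far in round `ρ`.
      · have h3 : (I.far (dyad ρ) s.S).card < (s.inferior d I).card := by
          rw [decides, if_pos hj] at hP
          omega
        obtain ⟨i, hi, hi'⟩ := Finset.exists_mem_notMem_of_card_lt_card h3
        have hiS : i ∈ s.S := (Finset.mem_filter.1 hi).1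
        have h4 : I.gap i < dyad ρ := by
          rw [I.mem_far] at hi'
          exact not_le.1 fun h => hi' ⟨hiS, h⟩
        exact hh.trans (I.elimCount_lt hρ (gap_of_mem_inferior hi) h4)
    · exact hs.count' (Or.inr hj)
  · exact hs.exists_near
  · exact fun _ => h2

theorem Healthy.succ_not_decides (hs : s.Healthy d I) (he : s.e = false) (hQ : ¬ 2 ≤ s.Q.card)
    (hw : I.mean (s.winner d) - s.eps / 8 < s.average d c y (s.winner d))
    (hhigh : 16 * (s.high d c I s.S (s.eps / 8) y).card ≤ s.S.card)
    (hP : ¬ s.decides d (s.comparison d c y)) :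
    (s.succ d (s.comparison d c y)).Healthy d I := by
  have hS : 0 < s.S.card := Finset.card_pos.2 ⟨_, hs.best_mem⟩
  have h1 : s.r ∈ I.classes ∨ s.j ≠ 0 → _ := fun h =>
    s.card_far_le_worse_add d c I he hQ (s.gap_winner_le d I hQ (hs.exists_near h)) hw
  have h2 : s.j ≠ 0 → 16 * (I.far s.eps s.S).card < 5 * s.S.card := by
    intro hj
    have := h1 (Or.inr hj)
    rw [decides, if_neg hj] at hP
    omega
  have e : 2 * dyad (s.r + 1) = s.eps := by rw [dyad_succ, eps]; ring
  refine ⟨hs.toSound.succ d (by simp [he]) fun _ hQ' => absurd hQ' hQ,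
    ?_, ?_, ?_, ?_, ?_⟩ <;> rw [succ_of_not_decides he hQ hP]
  · intro _ _
    simp only [eps] at e ⊢
    rw [e]
    by_cases hj : s.j = 0
    · by_cases hr : s.r ∈ I.classes
      · have := h1 (Or.inl hr)
        rw [decides, if_pos hj] at hP
        simp only [eps] at this hhigh
        omega
      -- The winner may be bad in this case; the bound is inherited because the set of far arms does
      -- not change.
      · rw [I.far_eq_of_notMem_classes hr]
        exact hs.far_le he hj
    · have := h2 hj
      simp only [eps] at this
      omega
  · intro _ _
    by_cases hj : s.j = 0
    · simp only [hj, if_true]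
      exact (hs.count he hj).imp id fun ⟨ρ, hρ, h⟩ => ⟨ρ, hρ.trans (Nat.lt_succ_self _), h⟩
    · simp only [hj, if_false]
      exact Or.inr ⟨s.r, Nat.lt_succ_self _, Nat.succ_le_succ (hs.count' (Or.inr hj)), h2 hj⟩
  · simp
  · intro _
    exact ⟨I.best, hs.best_mem, by simp [I.gap_best]⟩
  · simp

theorem Healthy.succ_elim (hs : s.Healthy d I) (he : s.e = true)
    (hw : s.average d c y (s.winner d) < I.mean (s.winner d) + s.eps / 16)
    (hb : I.mean I.best - s.eps / 16 < s.average d c y I.best) :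
    (s.succ d (s.comparison d c y)).Healthy d I := by
  have hk := s.best_mem_kept d c I hs.best_mem he hw hb
  refine ⟨hs.toSound.succ d (fun _ => hk) (by simp [he]), ?_, ?_, ?_, ?_, ?_⟩ <;>
    rw [succ_of_elim he]
  · simp
  · simp
  · exact fun _ => hs.count' (Or.inl he)
  · exact fun _ => ⟨I.best, hk, by simp [I.gap_best]⟩
  · simp

theorem Healthy.card_kept_le (hs : s.Healthy d I) (he : s.e = true)
    (hw : I.mean (s.winner d) - s.eps / 16 < s.average d c y (s.winner d))
    (hhigh : 16 * (s.high d c I s.S (s.eps / 16) y).card ≤ s.S.card) :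
    8 * (s.kept d (s.comparison d c y)).card ≤ 7 * s.S.card := by
  have h1 := s.card_kept_add_le d c I he hw
  have h2 := hs.card_inferior he
  omega

theorem healthy_init (d : Fin n) (c : ℕ) (I : BestArmInstance n) :
    (elimMachine d c).init.Healthy d I := by
  refine ⟨⟨Finset.mem_univ _, subset_rfl, ⟨d, Finset.mem_univ _⟩⟩, ?_, ?_, ?_, ?_, ?_⟩
  · intro _ _
    have : I.far (2 * (elimMachine d c).init.eps) (elimMachine d c).init.S = ∅ := by
      ext i
      simp only [I.mem_far, Finset.notMem_empty, iff_false, not_and, not_le]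
      intro _
      have : (elimMachine d c).init.eps = 1 := dyad_zero
      linarith [I.gap_le_one i]
    rw [this]; simp
  · exact fun _ _ => Or.inl rfl
  · simp [elimMachine]
  · exact fun _ => ⟨I.best, Finset.mem_univ _, by simp [I.gap_best, elimMachine]⟩
  · simp [elimMachine]

end ElimState

/-! ### The potential for failures. -/

namespace BestArmInstance

variable {n : ℕ} (I : BestArmInstance n)

/-- The number of nonempty dyadic gap classes of index at least `r`. -/
def classesFrom (r : ℕ) : ℕ := (I.classes.filter fun s => r ≤ s).card

theorem classesFrom_eq (r : ℕ) :
    I.classesFrom r = I.classesFrom (r + 1) + if r ∈ I.classes then 1 else 0 := by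
  unfold classesFrom
  split_ifs with h
  · have : (I.classes.filter fun s => r ≤ s) = insert r (I.classes.filter fun s => r + 1 ≤ s) := by
      ext s
      simp only [Finset.mem_filter, Finset.mem_insert]
      constructor
      · rintro ⟨h1, h2⟩
        by_cases hs : s = r
        · exact Or.inl hs
        · exact Or.inr ⟨h1, by omega⟩
      · rintro (rfl | ⟨h1, h2⟩)
        · exact ⟨h, le_rfl⟩
        · exact ⟨h1, by omega⟩
    rw [this, Finset.card_insert_of_notMem (by simp)]
  · rw [add_zero]
    congr 1
    ext s
    simp only [Finset.mem_filter]
    refine and_congr_right fun hs => ⟨fun h2 => ?_, fun h2 => by omega⟩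
    rcases h2.eq_or_lt with rfl | h3
    · exact absurd hs h
    · omega

/-- The number of arms with a gap below `2 ^ (-r + 1)`. -/
def near (r : ℕ) : ℕ := open Classical in (Finset.univ.filter fun i => I.gap i < 2 * dyad r).card

end BestArmInstance

namespace ElimState

variable {n : ℕ} (d : Fin n) (c : ℕ) (s : ElimState n) (I : BestArmInstance n)

/-- The part of the failure potential that belongs to the rounds from `r` on. -/
def roundsBound (r : ℕ) : ℝ := 4 * I.classesFrom r + 4 / (r + 1)

/-- The potential for the probability that a relevant estimate fails. -/
def failBound : ℝ :=
  Real.exp (-c) *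
    if s.e then 16 * (1 / 2) ^ (s.h + s.j) + roundsBound I (s.r + 1) + 16 * (1 / 2) ^ s.h
    else if s.j = 0 then
      (if s.r ∈ I.classes then 4 * (1 / 2) ^ s.l else 0) + 4 / (s.r + 1) +
        4 * I.classesFrom (s.r + 1) + 32 * (1 / 2) ^ s.h
    else 4 * (1 / 2) ^ (s.h + s.j + s.l) + 20 * (1 / 2) ^ (s.h + s.j) +
      roundsBound I (s.r + 1) + 16 * (1 / 2) ^ s.h

theorem roundsBound_nonneg (r : ℕ) : 0 ≤ roundsBound I r := by unfold roundsBound; positivity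

theorem failBound_nonneg : 0 ≤ s.failBound c I := by
  have := roundsBound_nonneg I (s.r + 1)
  unfold failBound
  split_ifs <;> positivity

/-- The failure potential after the test that ends a tournament. -/
def testBound : ℝ :=
  Real.exp (-c) * (16 * (1 / 2) ^ (s.h + s.j) + roundsBound I (s.r + 1) + 16 * (1 / 2) ^ s.h)

theorem testBound_nonneg : 0 ≤ s.testBound c I := by
  have := roundsBound_nonneg I (s.r + 1)
  unfold testBound; positivity

/-- The failure probability of one stage of the tournament. -/
def stageFailure : ℝ :=
  open Classical in
  if s.r ∈ I.classes ∨ s.j ≠ 0 then Real.exp (-c) * (2 * (1 / 2) ^ (s.h + s.j + s.l)) else 0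

theorem stageFailure_nonneg : 0 ≤ s.stageFailure c I := by
  unfold stageFailure; split_ifs <;> positivity

variable {s I} {P : Fin n → Fin n → Prop}

/-- Each stage spends half of the summand that decays with `l`. In a round with an empty class
nothing is charged before the first elimination. -/
theorem failBound_succ_tournament (he : s.e = false) (hQ : 2 ≤ s.Q.card) :
    s.stageFailure c I + (s.succ d P).failBound c I ≤ s.failBound c I := by
  rw [succ_of_tournament he hQ]
  unfold failBound stageFailure
  simp only [he, Bool.false_eq_true, if_false]
  have hc := Real.exp_pos (-(c : ℝ))
  by_cases hj : s.j = 0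
  · by_cases hr : s.r ∈ I.classes
    · simp only [hj, hr, if_true, true_or, ← mul_add]
      refine mul_le_mul_of_nonneg_left ?_ hc.le
      have : ((1 : ℝ) / 2) ^ (s.h + 0 + s.l) ≤ (1 / 2) ^ s.l :=
        pow_le_pow_of_le_one (by norm_num) (by norm_num) (by omega)
      rw [pow_succ]
      linarith
    · simp [hj, hr]
  · simp only [hj, if_false, or_true, ne_eq, not_false_iff, if_true, ← mul_add]
    refine mul_le_mul_of_nonneg_left (le_of_eq ?_) hc.le
    rw [← add_assoc (s.h + s.j), pow_succ]
    ring

/-- For first tests the bound `4 / ((r + 1) * (r + 2))` telescopes over the rounds. -/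
theorem exp_neg_testLevel_le :
    4 * Real.exp (-(s.testLevel c : ℝ)) ≤ Real.exp (-c) *
      (if s.j = 0 then 4 / ((s.r : ℝ) + 1) - 4 / ((s.r : ℝ) + 2)
        else 4 * (1 / 2 : ℝ) ^ (s.h + s.j) : ℝ) := by
  unfold testLevel
  split_ifs with hj
  · have h1 := exp_neg_add_le c (2 * Nat.clog 2 (s.r + 2))
    have h2 : ((s.r : ℝ) + 2) ≤ 2 ^ Nat.clog 2 (s.r + 2) := by
      exact_mod_cast Nat.le_pow_clog (by norm_num) (s.r + 2)
    have h3 : ((1 : ℝ) / 2) ^ (2 * Nat.clog 2 (s.r + 2)) ≤ 1 / ((s.r + 1) * (s.r + 2)) := by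
      rw [mul_comm 2, pow_mul, div_pow, one_pow, div_pow, one_pow]
      refine one_div_le_one_div_of_le (by positivity) ?_
      nlinarith
    have h4 : (4 : ℝ) / (s.r + 1) - 4 / (s.r + 2) = 4 * (1 / ((s.r + 1) * (s.r + 2))) := by
      field_simp; ring
    rw [h4]
    have := mul_le_mul_of_nonneg_left h3 (Real.exp_nonneg (-(c : ℝ)))
    linarith
  · have h1 := exp_neg_add_le c (s.h + s.j)
    rw [← add_assoc] at h1
    linarith

theorem testFailure_add_testBound_le (he : s.e = false) :
    4 * Real.exp (-(s.testLevel c : ℝ)) + s.testBound c I ≤ s.failBound c I := by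
  refine (add_le_add_left (exp_neg_testLevel_le c) _).trans ?_
  unfold testBound failBound
  have hc := Real.exp_pos (-(c : ℝ))
  simp only [he, Bool.false_eq_true, if_false, ← mul_add]
  refine mul_le_mul_of_nonneg_left ?_ hc.le
  by_cases hj : s.j = 0
  · simp only [hj, if_true, roundsBound]
    have h1 : (0 : ℝ) ≤ if s.r ∈ I.classes then 4 * (1 / 2) ^ s.l else 0 := by
      split_ifs <;> positivity
    push_cast
    have h2 : (s.r : ℝ) + 1 + 1 = s.r + 2 := by ring
    rw [h2, add_zero]
    linarith
  · simp only [hj, if_false]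
    have h1 : (0 : ℝ) ≤ 4 * (1 / 2) ^ (s.h + s.j + s.l) := by positivity
    linarith

/-- If the round ends, the next state needs `32 * (1 / 2) ^ h` with the new `h`. Without
eliminations the two summands with factor `16` coincide and give this; with eliminations the last of
them alone suffices. -/
theorem failBound_succ_test (he : s.e = false) (hQ : ¬ 2 ≤ s.Q.card) :
    (s.succ d P).failBound c I ≤ s.testBound c I := by
  by_cases hP : s.decides d P
  · rw [succ_of_decides he hQ hP]
    exact le_of_eq (by simp [failBound, testBound])
  · rw [succ_of_not_decides he hQ hP]
    unfold failBound testBound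
    refine mul_le_mul_of_nonneg_left ?_ (Real.exp_nonneg _)
    simp only [Bool.false_eq_true, if_false, if_true, pow_zero, mul_one, roundsBound]
    rw [I.classesFrom_eq (s.r + 1)]
    have h1 : (0 : ℝ) ≤ (1 / 2) ^ (s.h + s.j) := by positivity
    push_cast
    by_cases hj : s.j = 0
    · simp only [hj, if_true, add_zero]
      split_ifs <;> linarith
    · simp only [hj, if_false, pow_succ]
      split_ifs <;> linarith

/-- The coefficients balance as `16 = 4 + (4 + 20) / 2`. -/
theorem elimFailure_add_failBound_le (he : s.e = true) :
    4 * Real.exp (-((c + (s.h + s.j) : ℕ) : ℝ)) + (s.succ d P).failBound c I ≤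
      s.failBound c I := by
  have h1 := exp_neg_add_le c (s.h + s.j)
  rw [succ_of_elim he]
  unfold failBound
  simp only [he, if_true, Bool.false_eq_true, if_false, Nat.add_eq_zero_iff, one_ne_zero, and_false,
    ← add_assoc, add_zero, pow_succ] at h1 ⊢
  push_cast at h1 ⊢
  linarith

theorem failBound_init_le (d : Fin n) (c : ℕ) (I : BestArmInstance n) :
    (elimMachine d c).init.failBound c I ≤ (40 + 4 * I.classes.card) * Real.exp (-c) := by
  have h1 : I.classesFrom 0 ≤ I.classes.card := Finset.card_filter_le _ _
  have h2 := I.classesFrom_eq 0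
  unfold failBound
  rw [mul_comm]
  refine mul_le_mul_of_nonneg_right ?_ (Real.exp_nonneg _)
  have h3 : (I.classesFrom 0 : ℝ) ≤ I.classes.card := by exact_mod_cast h1
  rw [h2] at h3
  push_cast at h3
  simp only [elimMachine, Bool.false_eq_true, if_false, if_true, pow_zero, Nat.cast_zero]
  split_ifs at h3 ⊢ <;> linarith

end ElimState

/-! ### The potential for the number of pulls. -/

namespace ElimState

variable {n : ℕ} (d : Fin n) (c : ℕ) (s : ElimState n) (I : BestArmInstance n)

/-- A bound for the number of rounds with eliminations in a run without failures. -/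
def elimRounds : ℕ := 3 * I.classes.card + 1

/-- A bound for the number of pulls in the round `r`. -/
def roundCost (r : ℕ) : ℝ :=
  2 ^ 24 * 4 ^ r * I.near r * (c + elimRounds I + 12) + 2 ^ 13 * 4 ^ r * Nat.clog 2 (r + 2)

/-- A bound for the number of pulls in the rounds from `r` to `R`. -/
def roundsCost (R r : ℕ) : ℝ := ∑ k ∈ Finset.Ico r (R + 1), roundCost c I k

/-- The confidence level of the eliminations. -/
def level : ℝ := c + s.h + s.j + 12

/-- A bound for the number of pulls in a round after the next elimination. -/
def restCost (R : ℕ) : ℝ :=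
  15 * 2 ^ 19 * 4 ^ s.r * s.S.card * s.level c + roundsCost c I R (s.r + 1)

/-- The potential for the number of pulls. -/
def costBound (R : ℕ) : ℝ :=
  if s.S.card ≤ 1 then 0
  else if s.e then 512 * 4 ^ s.r * s.S.card * s.level c + s.restCost c I R
  else 18 * 2 ^ 14 * 4 ^ s.r * s.Q.card * (16 / 9) ^ s.l * (s.level c + s.l) +
    3072 * 4 ^ s.r * s.S.card * s.level c +
    (if s.j = 0 then (2 : ℝ) ^ 13 * 4 ^ s.r * Nat.clog 2 (s.r + 2) else 0) + s.restCost c I R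

variable {R : ℕ}

theorem level_nonneg : 0 ≤ s.level c := by unfold level; positivity

theorem roundCost_nonneg (r : ℕ) : 0 ≤ roundCost c I r := by unfold roundCost; positivity

theorem roundsCost_nonneg (r : ℕ) : 0 ≤ roundsCost c I R r :=
  Finset.sum_nonneg fun _ _ => roundCost_nonneg c I _

theorem restCost_nonneg : 0 ≤ s.restCost c I R := by
  have := s.level_nonneg c
  have := roundsCost_nonneg (R := R) c I (s.r + 1)
  unfold restCost; positivity

theorem costBound_nonneg : 0 ≤ s.costBound c I R := by
  have := s.level_nonneg c
  have := s.restCost_nonneg (R := R) c I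
  unfold costBound; split_ifs <;> positivity

variable {d c s I} {P : Fin n → Fin n → Prop}

theorem Healthy.h_le (hs : s.Healthy d I) : s.h ≤ elimRounds I := by
  unfold elimRounds
  have h3 := I.elimCount_le
  by_cases h : s.e = true ∨ s.j ≠ 0
  · have := hs.count' h
    have := h3 s.r
    omega
  · have he : s.e = false := by simpa using fun h' => h (Or.inl h')
    have hj : s.j = 0 := by by_contra h'; exact h (Or.inr h')
    rcases hs.count he hj with h | ⟨ρ, _, h, _⟩
    · omega
    · have := h3 ρ
      omega

theorem Healthy.card_le_near (hs : s.Healthy d I) (he : s.e = false) (hj : s.j = 0) :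
    s.S.card ≤ 2 * I.near s.r := by
  classical
  have h1 := hs.far_le he hj
  have h2 : s.S ⊆ I.far (2 * s.eps) s.S ∪ Finset.univ.filter fun i => I.gap i < 2 * dyad s.r := by
    intro i hi
    simp only [Finset.mem_union, I.mem_far, hi, true_and, Finset.mem_filter, Finset.mem_univ, eps]
    exact le_or_gt _ _
  have h3 := (Finset.card_le_card h2).trans (Finset.card_union_le _ _)
  have h4 : I.near s.r = (Finset.univ.filter fun i => I.gap i < 2 * dyad s.r).card := by
    unfold BestArmInstance.near; congr!
  omega

/-- Otherwise all survivors but the best arm are far, and `16 * (|S| - 1) ≤ 7 * |S|` forces `|S| ≤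
1`. -/
theorem Healthy.r_le (hs : s.Healthy d I) (he : s.e = false) (hj : s.j = 0)
    (hR : ∀ r, (∃ i, i ≠ I.best ∧ I.gap i < 2 * dyad r) → r ≤ R) (hS : ¬ s.S.card ≤ 1) :
    s.r ≤ R := by
  refine hR _ ?_
  by_contra! hcon
  have h1 : s.S.erase I.best ⊆ I.far (2 * s.eps) s.S := by
    intro i hi
    rw [Finset.mem_erase] at hi
    exact I.mem_far.2 ⟨hi.2, hcon i hi.1⟩
  have h2 := Finset.card_le_card h1
  rw [Finset.card_erase_of_mem hs.best_mem] at h2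
  have := hs.far_le he hj
  omega

/-- At the beginning of a round. -/
theorem Healthy.costBound_le (hs : s.Healthy d I) (he : s.e = false) (hj : s.j = 0)
    (hl : s.l = 0) (hQ : s.Q = s.S)
    (hR : ∀ r, (∃ i, i ≠ I.best ∧ I.gap i < 2 * dyad r) → r ≤ R) :
    s.costBound c I R ≤ roundsCost c I R s.r := by
  unfold costBound
  by_cases hS : s.S.card ≤ 1
  · rw [if_pos hS]; exact roundsCost_nonneg c I _
  have h1 : s.r < R + 1 := Nat.lt_succ_of_le (hs.r_le he hj hR hS)
  rw [if_neg hS, he, hj, hl, hQ, roundsCost, Finset.sum_eq_sum_Ico_succ_bot h1, restCost,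
    roundCost]
  simp only [Bool.false_eq_true, if_false, if_true, pow_zero, mul_one, Nat.cast_zero, add_zero]
  have h2 : (s.S.card : ℝ) ≤ 2 * I.near s.r := by exact_mod_cast hs.card_le_near he hj
  have h3 : s.level c ≤ c + elimRounds I + 12 := by
    have : (s.h : ℝ) ≤ elimRounds I := by exact_mod_cast hs.h_le
    unfold level; rw [hj]; push_cast; linarith
  have h4 : (4 : ℝ) ^ s.r * (s.S.card * s.level c) ≤
      4 ^ s.r * (2 * I.near s.r * (c + elimRounds I + 12)) := by
    refine mul_le_mul_of_nonneg_left ?_ (by positivity)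
    exact mul_le_mul h2 h3 (s.level_nonneg c) (by positivity)
  have h5 : 0 ≤ (4 : ℝ) ^ s.r * (s.S.card * s.level c) := by
    have := s.level_nonneg c
    positivity
  change _ ≤ _ + roundsCost c I R (s.r + 1)
  linarith

/-- The set shrinks by `7/8` and the level, being at least `32`, grows by at most `33/32`; the
product is below `15/16`. All later cycles of the round therefore form a geometric series, and the
constants fit as `18 * 2 ^ 14 + 3072 + 15 * 2 ^ 19 ≤ 2 ^ 23`. -/
theorem costBound_succ_elim_le (hc : 20 ≤ c) (he : s.e = true)
    (hk : 8 * (s.kept d P).card ≤ 7 * s.S.card) :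
    (s.succ d P).costBound c I R ≤ s.restCost c I R := by
  rw [succ_of_elim he]
  unfold costBound
  by_cases hS : (s.kept d P).card ≤ 1
  · rw [if_pos hS]; exact restCost_nonneg c s I
  simp only [hS, if_false, Bool.false_eq_true, Nat.add_eq_zero_iff, one_ne_zero, and_false,
    pow_zero, mul_one, Nat.cast_zero, add_zero]
  have h1 : (8 : ℝ) * (s.kept d P).card ≤ 7 * s.S.card := by exact_mod_cast hk
  have h2 : (20 : ℝ) ≤ c := by exact_mod_cast hc
  unfold restCost level
  push_cast
  set x : ℝ := ((s.kept d P).card : ℝ)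
  set z : ℝ := (s.S.card : ℝ)
  set Y : ℝ := c + s.h + s.j + 12 with hY
  have h3 : (32 : ℝ) ≤ Y := by
    have : (0 : ℝ) ≤ s.h := by positivity
    have : (0 : ℝ) ≤ s.j := by positivity
    rw [hY]; linarith
  have hx : 0 ≤ x := Nat.cast_nonneg _
  have e : (c : ℝ) + s.h + (s.j + 1) + 12 = Y + 1 := by rw [hY]; ring
  rw [e]
  have h4 : x * (Y + 1) * 16 ≤ 15 * (z * Y) := by nlinarith
  have h5 := mul_le_mul_of_nonneg_left h4 (by positivity : (0 : ℝ) ≤ 4 ^ s.r)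
  have h6 : 0 ≤ (4 : ℝ) ^ s.r * (x * (Y + 1)) := by positivity
  linarith

theorem length_plan_of_elim (hS : ¬ s.S.card ≤ 1) (he : s.e = true) :
    ((s.plan d c).length : ℝ) = 512 * 4 ^ s.r * s.S.card * s.level c := by
  have : (s.plan d c).length = 512 * 4 ^ s.r * (c + s.h + s.j + 12) * s.S.card := by
    rw [length_plan]
    simp only [pulls, hS, he, if_true, if_false, Finset.sum_ite_mem, Finset.univ_inter,
      Finset.sum_const, smul_eq_mul]
    ring
  rw [this]
  unfold level
  push_cast
  ring

theorem length_plan_of_test_le (hc : 20 ≤ c) (hS : ¬ s.S.card ≤ 1) (he : s.e = false)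
    (hQ : ¬ 2 ≤ s.Q.card) :
    ((s.plan d c).length : ℝ) ≤ 2560 * 4 ^ s.r * s.S.card * s.level c +
      if s.j = 0 then (2 : ℝ) ^ 13 * 4 ^ s.r * Nat.clog 2 (s.r + 2) else 0 := by
  classical
  have h1 : (s.plan d c).length ≤
      128 * 4 ^ s.r * (40 * s.S.card + 17 * s.testLevel c) := by
    have e : (s.plan d c).length = ∑ i ∈ s.S, 128 * 4 ^ s.r *
        (12 + 16 * (s.testLevel c / s.S.card + 1) +
          if i = s.winner d then s.testLevel c + 12 else 0) := by
      rw [length_plan]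
      simp only [pulls, hS, he, hQ, if_false, Bool.false_eq_true, Finset.sum_ite_mem,
        Finset.univ_inter]
    rw [e, ← Finset.mul_sum, Finset.sum_add_distrib, Finset.sum_const, smul_eq_mul,
      Finset.sum_ite_eq']
    refine Nat.mul_le_mul_left _ ?_
    have h2 : s.S.card * (s.testLevel c / s.S.card) ≤ s.testLevel c := Nat.mul_div_le _ _
    split_ifs <;> nlinarith
  have h2 : ((s.plan d c).length : ℝ) ≤
      128 * 4 ^ s.r * (40 * s.S.card + 17 * s.testLevel c) := by exact_mod_cast h1
  refine h2.trans ?_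
  have h3 : (20 : ℝ) ≤ c := by exact_mod_cast hc
  have h4 : (32 : ℝ) ≤ s.level c := by
    unfold level
    have : (0 : ℝ) ≤ s.h := by positivity
    have : (0 : ℝ) ≤ s.j := by positivity
    linarith
  have h5 : (1 : ℝ) ≤ s.S.card := by exact_mod_cast (by omega : 1 ≤ s.S.card)
  have h6 : (32 : ℝ) * s.S.card ≤ s.S.card * s.level c := by nlinarith
  have h7 : s.level c ≤ s.S.card * s.level c := by nlinarith
  have h8 : (40 : ℝ) * s.S.card + 17 * s.testLevel c ≤ 20 * (s.S.card * s.level c) +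
      if s.j = 0 then (64 : ℝ) * Nat.clog 2 (s.r + 2) else 0 := by
    unfold testLevel
    have : (0 : ℝ) ≤ s.h := by positivity
    have : (0 : ℝ) ≤ (Nat.clog 2 (s.r + 2) : ℕ) := by positivity
    have h9 : s.level c = c + s.h + s.j + 12 := rfl
    have : (0 : ℝ) ≤ s.j := by positivity
    split_ifs <;> push_cast <;> linarith
  have h9 := mul_le_mul_of_nonneg_left h8 (by positivity : (0 : ℝ) ≤ 128 * 4 ^ s.r)
  refine h9.trans (le_of_eq ?_)
  split_ifs <;> ring

theorem costBound_succ_test_le {d' : Fin n} (hS : ¬ s.S.card ≤ 1) (he : s.e = false)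
    (hQ : ¬ 2 ≤ s.Q.card) (hs : (s.succ d P).Healthy d' I)
    (hR : ∀ r, (∃ i, i ≠ I.best ∧ I.gap i < 2 * dyad r) → r ≤ R) :
    (s.succ d P).costBound c I R ≤
      512 * 4 ^ s.r * s.S.card * s.level c + s.restCost c I R := by
  by_cases hP : s.decides d P
  · rw [succ_of_decides he hQ hP]
    unfold costBound
    simp only [hS, if_false, if_true]
    exact le_rfl
  · rw [succ_of_not_decides he hQ hP] at hs ⊢
    refine (hs.costBound_le rfl rfl rfl rfl hR).trans ?_
    have := s.level_nonneg c
    have h1 : 0 ≤ 512 * (4 : ℝ) ^ s.r * s.S.card * s.level c := by positivity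
    have h2 : 0 ≤ 15 * 2 ^ 19 * (4 : ℝ) ^ s.r * s.S.card * s.level c := by positivity
    unfold restCost
    linarith

theorem length_plan_of_tournament_le (hS : ¬ s.S.card ≤ 1) (he : s.e = false)
    (hQ : 2 ≤ s.Q.card) :
    ((s.plan d c).length : ℝ) ≤
      2 ^ 14 * 4 ^ s.r * s.Q.card * (16 / 9) ^ s.l * (s.level c + s.l) := by
  have e : (s.plan d c).length = 8192 * 4 ^ s.r * ⌈((16 : ℝ) / 9) ^ s.l⌉₊ *
      (c + s.h + s.j + s.l + 12) * s.Q.card := by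
    rw [length_plan]
    simp only [pulls, hS, he, hQ, if_true, if_false, Bool.false_eq_true, Finset.sum_ite_mem,
      Finset.univ_inter, Finset.sum_const, smul_eq_mul]
    ring
  have h1 : (1 : ℝ) ≤ (16 / 9) ^ s.l := one_le_pow₀ (by norm_num)
  have h2 : (⌈((16 : ℝ) / 9) ^ s.l⌉₊ : ℝ) ≤ 2 * (16 / 9) ^ s.l := by
    have := Nat.ceil_lt_add_one (zero_le_one.trans h1)
    linarith
  rw [e]
  push_cast
  have h3 : (c : ℝ) + s.h + s.j + s.l + 12 = s.level c + s.l := by unfold level; ring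
  rw [h3]
  have := s.level_nonneg c
  calc _ = 8192 * 4 ^ s.r * (s.level c + s.l) * s.Q.card * ⌈((16 : ℝ) / 9) ^ s.l⌉₊ := by ring
    _ ≤ 8192 * 4 ^ s.r * (s.level c + s.l) * s.Q.card * (2 * (16 / 9) ^ s.l) :=
        mul_le_mul_of_nonneg_left h2 (by positivity)
    _ = _ := by ring

/-- From one stage to the next the cost changes by at most the factor `(1/2) * (16/9) * (17/16) =
17/18`, from the halving, the finer accuracy and the higher level. Hence the factor `18` in the
potential. -/
theorem length_plan_add_costBound_le (hc : 20 ≤ c) (hS : ¬ s.S.card ≤ 1) (he : s.e = false)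
    (hQ : 2 ≤ s.Q.card) (hQ' : (upperHalf s.Q P).card = s.Q.card / 2) :
    (s.plan d c).length + (s.succ d P).costBound c I R ≤ s.costBound c I R := by
  have h1 := s.length_plan_of_tournament_le (d := d) (c := c) hS he hQ
  rw [succ_of_tournament he hQ]
  unfold costBound
  simp only [hS, he, if_false, Bool.false_eq_true]
  have e1 : (⟨s.r, s.h, s.j, s.l + 1, false, s.S, upperHalf s.Q P⟩ : ElimState n).restCost c I R =
    s.restCost c I R := rfl
  have e2 : (⟨s.r, s.h, s.j, s.l + 1, false, s.S, upperHalf s.Q P⟩ : ElimState n).level c =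
    s.level c := rfl
  rw [e1, e2, hQ', pow_succ ((16 : ℝ) / 9) s.l]
  have h2 : ((s.Q.card / 2 : ℕ) : ℝ) ≤ s.Q.card / 2 := Nat.cast_div_le
  have h3 : (20 : ℝ) ≤ c := by exact_mod_cast hc
  have h4 : (32 : ℝ) ≤ s.level c := by
    unfold level
    have : (0 : ℝ) ≤ s.h := by positivity
    have : (0 : ℝ) ≤ s.j := by positivity
    linarith
  have h5 : (0 : ℝ) ≤ s.l := Nat.cast_nonneg _
  have h6 : ((s.Q.card / 2 : ℕ) : ℝ) * (s.level c + s.l + 1) * 16 ≤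
      s.Q.card / 2 * (17 * (s.level c + s.l)) := by
    have : (s.level c + s.l + 1) * 16 ≤ 17 * (s.level c + s.l) := by linarith
    rw [mul_assoc]
    exact mul_le_mul h2 this (by positivity) (by positivity)
  have h7 := mul_le_mul_of_nonneg_left h6
    (by positivity : (0 : ℝ) ≤ 2 ^ 15 * 4 ^ s.r * (16 / 9) ^ s.l)
  push_cast
  rw [← add_assoc (s.level c)]
  linarith

end ElimState

/-! ### Each epoch is paid for by the potentials. -/

namespace ElimState

variable {n : ℕ} {d : Fin n} {c : ℕ} {s : ElimState n} {I : BestArmInstance n} {R : ℕ}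

/-- The statement that the relevant estimates of an epoch are correct, except with a probability
that is paid for by the potential for failures, and that the number of pulls is paid for by the
potential for pulls. -/
def Progress (d : Fin n) (c : ℕ) (s : ElimState n) (I : BestArmInstance n) (R : ℕ) : Prop :=
  ∃ (E : Set (Fin n → ℝ)) (p q v : ℝ), 0 ≤ p ∧ 0 ≤ q ∧ 0 ≤ v ∧
    epochLaw I.law (s.plan d c) Eᶜ ≤ ENNReal.ofReal p ∧ p + q ≤ s.failBound c I ∧
    (s.plan d c).length + v ≤ s.costBound c I R ∧
    ∀ y ∈ E, (s.succ d (s.comparison d c y)).Healthy d I ∧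
      (s.succ d (s.comparison d c y)).failBound c I ≤ q ∧
      (s.succ d (s.comparison d c y)).costBound c I R ≤ v

/-- The constants are matched by `8192 / (2 * 64 ^ 2) = 1` and `(16/9) * (3/4) ^ 2 = 1`. Twice this
accuracy is the gap that stage `l` may lose. -/
theorem pulls_accuracy_of_tournament (hS : ¬ s.S.card ≤ 1) (he : s.e = false) (hQ : 2 ≤ s.Q.card)
    {i : Fin n} (hi : i ∈ s.Q) :
    ((c + (s.h + s.j + s.l) : ℕ) : ℝ) + 12 ≤
      s.pulls d c i * (s.eps * (3 / 4) ^ s.l / 64) ^ 2 / 2 := by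
  have e : s.pulls d c i =
      8192 * 4 ^ s.r * ⌈((16 : ℝ) / 9) ^ s.l⌉₊ * (c + s.h + s.j + s.l + 12) := by
    simp [pulls, hS, he, hQ, hi]
  have h1 := s.four_pow_mul_eps_sq
  have h2 := Nat.le_ceil (((16 : ℝ) / 9) ^ s.l)
  have h3 : ((16 : ℝ) / 9) ^ s.l * ((3 / 4) ^ s.l) ^ 2 = 1 := by
    rw [← pow_mul, mul_comm s.l 2, pow_mul, ← mul_pow]; norm_num
  rw [e]
  push_cast
  calc (c + (s.h + s.j + s.l) + 12 : ℝ)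
      = (4 ^ s.r * s.eps ^ 2) * ((16 / 9) ^ s.l * ((3 / 4) ^ s.l) ^ 2) *
          (c + s.h + s.j + s.l + 12) := by rw [h1, h3]; ring
    _ ≤ (4 ^ s.r * s.eps ^ 2) * (⌈((16 : ℝ) / 9) ^ s.l⌉₊ * ((3 / 4) ^ s.l) ^ 2) *
          (c + s.h + s.j + s.l + 12) := by gcongr
    _ = _ := by ring

theorem pulls_accuracy_of_test (hS : ¬ s.S.card ≤ 1) (he : s.e = false) (hQ : ¬ 2 ≤ s.Q.card)
    {i : Fin n} (hi : i ∈ s.S) :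
    ((16 * (s.testLevel c / s.S.card + 1) : ℕ) : ℝ) + 12 ≤
      s.pulls d c i * (s.eps / 8) ^ 2 / 2 := by
  have e : 128 * 4 ^ s.r * (12 + 16 * (s.testLevel c / s.S.card + 1)) ≤ s.pulls d c i := by
    simp only [pulls, hS, he, hQ, hi, if_false, if_true, Bool.false_eq_true]
    exact Nat.mul_le_mul_left _ (Nat.le_add_right _ _)
  have h1 := s.four_pow_mul_eps_sq
  have h2 : ((128 * 4 ^ s.r * (12 + 16 * (s.testLevel c / s.S.card + 1)) : ℕ) : ℝ) ≤
      s.pulls d c i := by exact_mod_cast e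
  rw [Nat.cast_mul, Nat.cast_add 12, Nat.cast_mul, Nat.cast_pow] at h2
  generalize 16 * (s.testLevel c / s.S.card + 1) = k at h2 ⊢
  calc (k : ℝ) + 12 = (4 ^ s.r * s.eps ^ 2) * (12 + k) := by rw [h1]; ring
    _ = (128 * 4 ^ s.r * (12 + k)) * (s.eps / 8) ^ 2 / 2 := by ring
    _ ≤ _ := by gcongr; simpa using h2

theorem pulls_accuracy_of_winner (hS : ¬ s.S.card ≤ 1) (he : s.e = false) (hQ : ¬ 2 ≤ s.Q.card)
    (hi : s.winner d ∈ s.S) :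
    (s.testLevel c : ℝ) + 12 ≤ s.pulls d c (s.winner d) * (s.eps / 8) ^ 2 / 2 := by
  have e : 128 * 4 ^ s.r * (s.testLevel c + 12) ≤ s.pulls d c (s.winner d) := by
    simp only [pulls, hS, he, hQ, hi, if_false, if_true, Bool.false_eq_true]
    exact Nat.mul_le_mul_left _ (Nat.le_add_left _ _)
  have h1 := s.four_pow_mul_eps_sq
  have h2 : ((128 * 4 ^ s.r * (s.testLevel c + 12) : ℕ) : ℝ) ≤
      s.pulls d c (s.winner d) := by exact_mod_cast e
  push_cast at h2
  calc (s.testLevel c : ℝ) + 12 = (4 ^ s.r * s.eps ^ 2) * (s.testLevel c + 12) := by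
        rw [h1]; ring
    _ = (128 * 4 ^ s.r * (s.testLevel c + 12)) * (s.eps / 8) ^ 2 / 2 := by ring
    _ ≤ _ := by gcongr

theorem Healthy.progress_tournament (hs : s.Healthy d I) (hc : 20 ≤ c) (hS : ¬ s.S.card ≤ 1)
    (he : s.e = false) (hQ : 2 ≤ s.Q.card) : s.Progress d c I R := by
  classical
  have hcard : ∀ y, (upperHalf s.Q (s.comparison d c y)).card = s.Q.card / 2 := fun y => by
    rw [upperHalf_comparison d c he hQ, card_upperHalf]
  have hcost := fun y => length_plan_add_costBound_le (d := d) (I := I) (R := R) hc hS he hQ (hcard y)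
  have hfail := fun y => failBound_succ_tournament d c (I := I) (P := s.comparison d c y) he hQ
  set a : ℝ := s.eps * (3 / 4) ^ s.l / 64 with ha_def
  have ha : 0 ≤ a := by have := s.eps_pos; positivity
  have hE : ∃ E : Set (Fin n → ℝ), epochLaw I.law (s.plan d c) Eᶜ ≤
      ENNReal.ofReal (s.stageFailure c I) ∧
      ∀ y ∈ E, s.r ∈ I.classes ∨ s.j ≠ 0 → ∃ i ∈ upperHalf s.Q (s.comparison d c y),
        I.gap i ≤ s.eps / 8 * (1 - (3 / 4) ^ (s.l + 1)) := by
    by_cases hrel : s.r ∈ I.classes ∨ s.j ≠ 0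
    · obtain ⟨x, hx, hgap⟩ := hs.exists_near hrel
      refine ⟨({y | s.Q.card / 2 ≤ (s.high d c I s.Q a y).card} ∪
        {y | s.average d c y x ≤ I.mean x - a})ᶜ, ?_, ?_⟩
      · rw [compl_compl]
        have h1 := s.measure_card_high_le d c I s.Q (t := s.Q.card / 2) ha (by omega) (Nat.cast_nonneg _)
          (fun i hi => pulls_accuracy_of_tournament hS he hQ hi)
        have h2 := s.measure_low_le d c I x ha (Nat.cast_nonneg _)
          (pulls_accuracy_of_tournament hS he hQ hx)
        refine (measure_union_le_ofReal (Real.exp_nonneg _) (Real.exp_nonneg _) h1 h2).trans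
          (ENNReal.ofReal_le_ofReal ?_)
        have h3 := exp_neg_add_le c (s.h + s.j + s.l)
        have h4 : Real.exp (-(((s.Q.card / 2 : ℕ) : ℝ) * ((c + (s.h + s.j + s.l) : ℕ) : ℝ))) ≤
            Real.exp (-((c + (s.h + s.j + s.l) : ℕ) : ℝ)) := by
          refine Real.exp_le_exp.2 (neg_le_neg (le_mul_of_one_le_left (Nat.cast_nonneg _) ?_))
          exact_mod_cast (by omega : 1 ≤ s.Q.card / 2)
        rw [stageFailure, if_pos hrel]
        linarith
      · intro y hy _
        simp only [Set.mem_compl_iff, Set.mem_union, Set.mem_ofPred_eq, not_or, not_le] at hy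
        obtain ⟨i, hi, h⟩ := s.exists_mem_upperHalf d c I he hQ ha hx hy.1 hy.2
        refine ⟨i, hi, h.trans ?_⟩
        rw [pow_succ]
        have : 2 * a = s.eps / 8 * ((3 / 4) ^ s.l - (3 / 4) ^ s.l * (3 / 4)) := by
          rw [ha_def]; ring
        linarith
    · exact ⟨Set.univ, by simp, fun y _ h => absurd h hrel⟩
  obtain ⟨E, hE, hnext⟩ := hE
  refine ⟨E, s.stageFailure c I, s.failBound c I - s.stageFailure c I,
    s.costBound c I R - (s.plan d c).length, stageFailure_nonneg c s I, ?_, ?_, hE, ?_, ?_, ?_⟩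
  · linarith [hfail 0, failBound_nonneg c (s.succ d (s.comparison d c 0)) I]
  · linarith [hcost 0, costBound_nonneg c (s.succ d (s.comparison d c 0)) I (R := R)]
  · linarith
  · linarith
  · exact fun y hy => ⟨hs.succ_tournament he hQ (hnext y hy), by linarith [hfail y],
      by linarith [hcost y]⟩

theorem Healthy.progress_test (hs : s.Healthy d I) (hc : 20 ≤ c) (hS : ¬ s.S.card ≤ 1)
    (he : s.e = false) (hQ : ¬ 2 ≤ s.Q.card)
    (hR : ∀ r, (∃ i, i ≠ I.best ∧ I.gap i < 2 * dyad r) → r ≤ R) : s.Progress d c I R := by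
  have ha : 0 ≤ s.eps / 8 := by have := s.eps_pos; positivity
  have hlevel := s.level_nonneg c
  have hrest := s.restCost_nonneg c I (R := R)
  refine ⟨(({y | I.mean (s.winner d) + s.eps / 8 ≤ s.average d c y (s.winner d)} ∪
      {y | s.average d c y (s.winner d) ≤ I.mean (s.winner d) - s.eps / 8}) ∪
      ({y | s.S.card / 16 + 1 ≤ (s.high d c I s.S (s.eps / 8) y).card} ∪
      {y | s.S.card / 16 + 1 ≤ (s.low d c I s.S (s.eps / 8) y).card}))ᶜ,
    4 * Real.exp (-(s.testLevel c : ℝ)), s.testBound c I,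
    512 * 4 ^ s.r * s.S.card * s.level c + s.restCost c I R, by positivity,
    testBound_nonneg c s I, by positivity, ?_, testFailure_add_testBound_le c he, ?_, ?_⟩
  · rw [compl_compl]
    have hw := pulls_accuracy_of_winner (c := c) hS he hQ (hs.winner_mem d)
    have h1 := s.measure_high_le d c I _ ha (Nat.cast_nonneg _) hw
    have h2 := s.measure_low_le d c I _ ha (Nat.cast_nonneg _) hw
    have h3 := s.measure_card_high_le d c I s.S (t := s.S.card / 16 + 1) ha (by omega) (Nat.cast_nonneg _)
      (fun i hi => pulls_accuracy_of_test hS he hQ hi)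
    have h4 := s.measure_card_low_le d c I s.S (t := s.S.card / 16 + 1) ha (by omega) (Nat.cast_nonneg _)
      (fun i hi => pulls_accuracy_of_test hS he hQ hi)
    -- The low level per arm suffices because more than `|S| / 16` arms must deviate together; the
    -- product of the two numbers is at least the full level.
    have h5 : Real.exp (-(((s.S.card / 16 + 1 : ℕ) : ℝ) *
        ((16 * (s.testLevel c / s.S.card + 1) : ℕ) : ℝ))) ≤ Real.exp (-(s.testLevel c : ℝ)) := by
      refine Real.exp_le_exp.2 (neg_le_neg ?_)
      rw [← Nat.cast_mul]
      refine Nat.cast_le.2 ?_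
      have h6 := (Nat.lt_mul_div_succ (s.testLevel c) (by omega : 0 < s.S.card)).le
      have h7 : s.S.card ≤ (s.S.card / 16 + 1) * 16 := by omega
      calc s.testLevel c ≤ s.S.card * (s.testLevel c / s.S.card + 1) := h6
        _ ≤ ((s.S.card / 16 + 1) * 16) * (s.testLevel c / s.S.card + 1) :=
            Nat.mul_le_mul_right _ h7
        _ = _ := by ring
    refine (measure_union_le_ofReal (by positivity) (by positivity)
      (measure_union_le_ofReal (Real.exp_nonneg _) (Real.exp_nonneg _) h1 h2)
      (measure_union_le_ofReal (Real.exp_nonneg _) (Real.exp_nonneg _) h3 h4)).trans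
      (ENNReal.ofReal_le_ofReal ?_)
    linarith
  · have h1 := s.length_plan_of_test_le (d := d) hc hS he hQ
    have h2 : 0 ≤ 18 * 2 ^ 14 * (4 : ℝ) ^ s.r * s.Q.card * (16 / 9) ^ s.l *
      (s.level c + s.l) := by positivity
    simp only [costBound, hS, he, if_false, Bool.false_eq_true]
    split_ifs at h1 ⊢ <;> linarith
  · intro y hy
    simp only [Set.mem_compl_iff, Set.mem_union, Set.mem_ofPred_eq, not_or, not_le] at hy
    obtain ⟨⟨h1, h2⟩, h3, h4⟩ := hy
    have hh : (s.succ d (s.comparison d c y)).Healthy d I := by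
      by_cases hP : s.decides d (s.comparison d c y)
      · exact hs.succ_decides he hQ h1 (by omega) hP
      · exact hs.succ_not_decides he hQ h2 (by omega) hP
    exact ⟨hh, failBound_succ_test d c he hQ, costBound_succ_test_le hS he hQ hh hR⟩

theorem Healthy.progress_elim (hs : s.Healthy d I) (hc : 20 ≤ c) (hS : ¬ s.S.card ≤ 1)
    (he : s.e = true) : s.Progress d c I R := by
  have ha : 0 ≤ s.eps / 16 := by have := s.eps_pos; positivity
  have hfail := fun P => elimFailure_add_failBound_le d c (I := I) (P := P) he
  refine ⟨(({y | I.mean (s.winner d) + s.eps / 16 ≤ s.average d c y (s.winner d)} ∪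
      {y | s.average d c y (s.winner d) ≤ I.mean (s.winner d) - s.eps / 16}) ∪
      ({y | s.average d c y I.best ≤ I.mean I.best - s.eps / 16} ∪
      {y | s.S.card / 16 + 1 ≤ (s.high d c I s.S (s.eps / 16) y).card}))ᶜ,
    4 * Real.exp (-((c + (s.h + s.j) : ℕ) : ℝ)),
    s.failBound c I - 4 * Real.exp (-((c + (s.h + s.j) : ℕ) : ℝ)),
    s.restCost c I R, by positivity, ?_, restCost_nonneg c s I, ?_, by linarith, ?_, ?_⟩
  · linarith [hfail (fun _ _ => False), failBound_nonneg c (s.succ d (fun _ _ => False)) I]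
  · rw [compl_compl]
    have hacc : ∀ i ∈ s.S, _ := fun i hi => s.pulls_accuracy_of_elim d c (by omega) he hi
    have h1 := s.measure_high_le d c I _ ha (Nat.cast_nonneg _) (hacc _ (hs.winner_mem d))
    have h2 := s.measure_low_le d c I _ ha (Nat.cast_nonneg _) (hacc _ (hs.winner_mem d))
    have h3 := s.measure_low_le d c I _ ha (Nat.cast_nonneg _) (hacc _ hs.best_mem)
    have h4 := s.measure_card_high_le d c I s.S (t := s.S.card / 16 + 1) ha (by omega) (Nat.cast_nonneg _) hacc
    have h5 : Real.exp (-(((s.S.card / 16 + 1 : ℕ) : ℝ) * ((c + (s.h + s.j) : ℕ) : ℝ))) ≤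
        Real.exp (-((c + (s.h + s.j) : ℕ) : ℝ)) := by
      refine Real.exp_le_exp.2 (neg_le_neg (le_mul_of_one_le_left (Nat.cast_nonneg _) ?_))
      exact_mod_cast Nat.le_add_left 1 _
    refine (measure_union_le_ofReal (by positivity) (by positivity)
      (measure_union_le_ofReal (Real.exp_nonneg _) (Real.exp_nonneg _) h1 h2)
      (measure_union_le_ofReal (Real.exp_nonneg _) (Real.exp_nonneg _) h3 h4)).trans
      (ENNReal.ofReal_le_ofReal ?_)
    linarith
  · rw [length_plan_of_elim hS he]
    simp only [costBound, hS, he, if_false, if_true]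
    exact le_rfl
  · intro y hy
    simp only [Set.mem_compl_iff, Set.mem_union, Set.mem_ofPred_eq, not_or, not_le] at hy
    obtain ⟨⟨h1, h2⟩, h3, h4⟩ := hy
    exact ⟨hs.succ_elim he h1 h3, by linarith [hfail (s.comparison d c y)],
      costBound_succ_elim_le hc he (hs.card_kept_le he h2 (by omega))⟩

end ElimState

open ElimState in
/-- The elimination procedure succeeds with high probability within the number of pulls given by
the potential. -/
theorem iterate_op_unsuccessful_le {n : ℕ} (I : BestArmInstance n) (d : Fin n) {c R N : ℕ}
    (hc : 20 ≤ c) (hR : ∀ r, (∃ i, i ≠ I.best ∧ I.gap i < 2 * dyad r) → r ≤ R)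
    (hN : roundsCost c I R 0 ≤ N) :
    ((elimMachine d c).op I.law)^[N] (((elimMachine d c).unsuccessful I.best).indicator 1)
      ((elimMachine d c).start (elimMachine d c).init) ≤
        ENNReal.ofReal ((40 + 4 * I.classes.card) * Real.exp (-c)) := by
  refine ((elimMachine d c).iterate_op_start_le_of_potential I.law
    (φ := ((elimMachine d c).unsuccessful I.best).indicator 1)
    (measurable_one.indicator (EpochMachine.measurableSet_unsuccessful _ _))
    (fun x => Set.indicator_le_self' (by simp) x)
    (fun s => s.Healthy d I) (fun s => s.costBound c I R) (fun s => s.failBound c I) ?_ ?_ N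
    (elimMachine d c).init (healthy_init d c I) ?_).trans
    (ENNReal.ofReal_le_ofReal (failBound_init_le d c I))
  · intro s hs hplan
    have hS : s.S.card ≤ 1 := (s.plan_eq_nil_iff d c).1 hplan
    refine Set.indicator_of_notMem (fun h => ?_) _
    exact (show ¬ _ from h) ⟨hplan, pick_eq_best d hs.toSound hS⟩
  · intro s hs hplan
    have hS : ¬ s.S.card ≤ 1 := mt (s.plan_eq_nil_iff d c).2 hplan
    by_cases he : s.e = true
    · exact hs.progress_elim hc hS he
    · have he : s.e = false := by simpa using he
      by_cases hQ : 2 ≤ s.Q.card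
      · exact hs.progress_tournament hc hS he hQ
      · exact hs.progress_test hc hS he hQ hR
  · exact ((healthy_init d c I).costBound_le rfl rfl rfl rfl hR).trans hN

/-! ### Summing the cost over the rounds. -/

theorem tsum_ofReal_mul_half_pow {x : ℝ} (hx : 0 ≤ x) :
    ∑' i : ℕ, ENNReal.ofReal (x * (1 / 2) ^ (i + 1)) = ENNReal.ofReal x := by
  have hs : Summable fun i : ℕ => (1 / 2 : ℝ) ^ i := summable_geometric_two
  have e : (fun i : ℕ => x * (1 / 2 : ℝ) ^ (i + 1)) = fun i : ℕ => (x / 2) * (1 / 2 : ℝ) ^ i := by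
    funext i; rw [pow_succ]; ring
  rw [← ENNReal.ofReal_tsum_of_nonneg (fun i => by positivity) (by rw [e]; exact hs.mul_left _), e,
    tsum_mul_left, tsum_geometric_two]
  congr 1; ring

theorem sum_four_pow_le (s : Finset ℕ) {x : ℝ} (hx : 0 ≤ x) (h : ∀ r ∈ s, (4 : ℝ) ^ r ≤ x) :
    ∑ r ∈ s, (4 : ℝ) ^ r ≤ 2 * x := by
  rcases s.eq_empty_or_nonempty with rfl | hs
  · simpa using hx
  · have h1 : s ⊆ Finset.range (s.max' hs + 1) := fun r hr =>
      Finset.mem_range.2 (Nat.lt_succ_of_le (s.le_max' r hr))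
    refine (Finset.sum_le_sum_of_subset_of_nonneg h1 fun _ _ _ => by positivity).trans ?_
    rw [geom_sum_eq (by norm_num), pow_succ]
    have := h _ (s.max'_mem hs)
    linarith

theorem clog_le_log (R : ℕ) {X : ℝ} (hR : (R : ℝ) ≤ 1 + 2 * X) :
    (Nat.clog 2 (R + 2) : ℝ) ≤ 5 + 2 * max 0 (Real.log X) := by
  have h1 : 1 ≤ Nat.clog 2 (R + 2) := Nat.clog_pos (by norm_num) (by omega)
  have h2 : (2 : ℝ) ^ (Nat.clog 2 (R + 2) - 1) ≤ R + 2 := by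
    have := Nat.pow_pred_clog_lt_self (b := 2) (by norm_num) (x := R + 2) (by omega)
    exact_mod_cast this.le
  have h3 : ((Nat.clog 2 (R + 2) : ℝ) - 1) * Real.log 2 ≤ Real.log (R + 2) := by
    have := Real.log_le_log (by positivity) h2
    rwa [Real.log_pow, Nat.cast_sub h1, Nat.cast_one] at this
  have h5 : Real.log 5 ≤ 2 := by
    rw [Real.log_le_iff_le_exp (by norm_num)]
    have h6 : Real.exp 2 = Real.exp 1 ^ 2 := by rw [← Real.exp_nat_mul]; norm_num
    rw [h6]
    nlinarith [Real.exp_one_gt_d9]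
  have h4 : Real.log (R + 2) ≤ 2 + max 0 (Real.log X) := by
    rcases le_total X 1 with h | h
    · have : Real.log (R + 2) ≤ Real.log 5 := Real.log_le_log (by positivity) (by linarith)
      linarith [le_max_left 0 (Real.log X)]
    · have : Real.log (R + 2) ≤ Real.log (5 * X) :=
        Real.log_le_log (by positivity) (by linarith)
      rw [Real.log_mul (by norm_num) (by positivity)] at this
      linarith [le_max_right 0 (Real.log X)]
  have h6 : (1 / 2 : ℝ) ≤ Real.log 2 := by linarith [Real.log_two_gt_d9]
  have h7 : (0 : ℝ) ≤ (Nat.clog 2 (R + 2) : ℝ) - 1 := by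
    have : (1 : ℝ) ≤ (Nat.clog 2 (R + 2) : ℝ) := by exact_mod_cast h1
    linarith
  nlinarith

namespace BestArmInstance

variable {n : ℕ} (I : BestArmInstance n)

theorem minGap_le {i : Fin n} (hi : i ≠ I.best) : I.minGap ≤ I.gap i :=
  ciInf_le (Set.finite_range _).bddBelow (⟨i, hi⟩ : {i : Fin n // i ≠ I.best})

theorem exists_ne_best (hn : 2 ≤ n) : ∃ i : Fin n, i ≠ I.best := by
  have : Nontrivial (Fin n) := Fin.nontrivial_iff_two_le.2 hn
  exact exists_ne _

theorem exists_gap_eq_minGap (hn : 2 ≤ n) : ∃ i, i ≠ I.best ∧ I.gap i = I.minGap := by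
  obtain ⟨k, hk⟩ := I.exists_ne_best hn
  have : Nonempty {i : Fin n // i ≠ I.best} := ⟨⟨k, hk⟩⟩
  obtain ⟨i, hi⟩ := exists_eq_ciInf_of_finite (f := fun i : {i : Fin n // i ≠ I.best} => I.gap i)
  exact ⟨i, i.2, hi⟩

theorem minGap_pos (hn : 2 ≤ n) : 0 < I.minGap := by
  obtain ⟨i, hi, h⟩ := I.exists_gap_eq_minGap hn
  exact h ▸ I.gap_pos hi

theorem minGap_le_one (hn : 2 ≤ n) : I.minGap ≤ 1 := by
  obtain ⟨i, hi, h⟩ := I.exists_gap_eq_minGap hn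
  exact h ▸ I.gap_le_one i

theorem inv_minGap_sq_le_complexity (hn : 2 ≤ n) : (I.minGap ^ 2)⁻¹ ≤ I.complexity := by
  obtain ⟨i, hi, h⟩ := I.exists_gap_eq_minGap hn
  rw [← h]
  exact Finset.single_le_sum (f := fun i => (I.gap i ^ 2)⁻¹) (fun _ _ => by positivity)
    (Finset.mem_erase.2 ⟨hi, Finset.mem_univ i⟩)

theorem one_le_complexity (hn : 2 ≤ n) : 1 ≤ I.complexity := by
  refine le_trans ?_ (I.inv_minGap_sq_le_complexity hn)
  exact (one_le_inv₀ (by have := I.minGap_pos hn; positivity)).2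
    (pow_le_one₀ (I.minGap_pos hn).le (I.minGap_le_one hn))

/-- The index of the last round of a run without failures. -/
def lastRound : ℕ := Nat.log 2 ⌊2 / I.minGap⌋₊

theorem two_pow_lt_of_gap_lt {r : ℕ} {i : Fin n} (hi : i ≠ I.best) (h : I.gap i < 2 * dyad r) :
    (2 : ℝ) ^ r < 2 / I.gap i := by
  rw [lt_div_iff₀ (I.gap_pos hi)]
  unfold dyad at h
  rw [← div_eq_mul_inv, lt_div_iff₀ (by positivity)] at h
  linarith

theorem le_lastRound (hn : 2 ≤ n) {r : ℕ} (h : ∃ i, i ≠ I.best ∧ I.gap i < 2 * dyad r) :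
    r ≤ I.lastRound := by
  obtain ⟨i, hi, h⟩ := h
  have h1 : (2 : ℝ) ^ r ≤ 2 / I.minGap := (I.two_pow_lt_of_gap_lt hi h).le.trans
    (div_le_div_of_nonneg_left (by norm_num) (I.minGap_pos hn) (I.minGap_le hi))
  refine Nat.le_log_of_pow_le (by norm_num) (Nat.le_floor ?_)
  exact_mod_cast h1

theorem two_pow_lastRound_le (hn : 2 ≤ n) : (2 : ℝ) ^ I.lastRound ≤ 2 / I.minGap := by
  have h1 : (1 : ℝ) ≤ 2 / I.minGap := by
    rw [le_div_iff₀ (I.minGap_pos hn)]; linarith [I.minGap_le_one hn]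
  have h2 : ⌊2 / I.minGap⌋₊ ≠ 0 := (Nat.floor_pos.2 h1).ne'
  have h3 : ((2 ^ I.lastRound : ℕ) : ℝ) ≤ (⌊2 / I.minGap⌋₊ : ℕ) :=
    Nat.cast_le.2 (Nat.pow_log_le_self 2 h2)
  push_cast at h3
  exact h3.trans (Nat.floor_le (by positivity))

theorem four_pow_lastRound_le (hn : 2 ≤ n) :
    (4 : ℝ) ^ I.lastRound ≤ 4 * (I.minGap ^ 2)⁻¹ := by
  have := pow_le_pow_left₀ (by positivity) (I.two_pow_lastRound_le hn) 2
  rw [← pow_mul, mul_comm, pow_mul, div_pow] at this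
  norm_num at this
  exact this

/-- Exchange the sums: an arm is near only while `2 ^ r < 2 / gap`, so its geometric sum is at most
`8 / gap ^ 2`. The best arm is near in all rounds and is charged to the second best. -/
theorem sum_four_pow_mul_near_le (hn : 2 ≤ n) :
    ∑ r ∈ Finset.range (I.lastRound + 1), (4 : ℝ) ^ r * I.near r ≤ 16 * I.complexity := by
  classical
  have e : ∀ r, (4 : ℝ) ^ r * I.near r =
      ∑ i, if I.gap i < 2 * dyad r then (4 : ℝ) ^ r else 0 := by
    intro r
    rw [← Finset.sum_filter, Finset.sum_const, nsmul_eq_mul, mul_comm]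
    congr 2
  simp_rw [e]
  rw [Finset.sum_comm, ← Finset.add_sum_erase _ _ (Finset.mem_univ I.best)]
  have hmem : ∀ r ∈ Finset.range (I.lastRound + 1), (4 : ℝ) ^ r ≤ 4 * (I.minGap ^ 2)⁻¹ :=
    fun r hr => (pow_le_pow_right₀ (by norm_num)
      (Nat.lt_succ_iff.1 (Finset.mem_range.1 hr))).trans (I.four_pow_lastRound_le hn)
  have hcx := I.inv_minGap_sq_le_complexity hn
  have h1 : ∑ r ∈ Finset.range (I.lastRound + 1),
      (if I.gap I.best < 2 * dyad r then (4 : ℝ) ^ r else 0) ≤ 8 * (I.minGap ^ 2)⁻¹ := by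
    rw [← Finset.sum_filter]
    refine (sum_four_pow_le _ (by positivity) fun r hr =>
      hmem r (Finset.mem_filter.1 hr).1).trans (le_of_eq (by ring))
  have h2 : ∀ i ∈ Finset.univ.erase I.best, ∑ r ∈ Finset.range (I.lastRound + 1),
      (if I.gap i < 2 * dyad r then (4 : ℝ) ^ r else 0) ≤ 8 * (I.gap i ^ 2)⁻¹ := by
    intro i hi
    have hi := (Finset.mem_erase.1 hi).1
    rw [← Finset.sum_filter]
    refine (sum_four_pow_le _ (x := 4 * (I.gap i ^ 2)⁻¹) (by positivity) fun r hr =>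
      ?_).trans (le_of_eq (by ring))
    have := pow_le_pow_left₀ (by positivity)
      (I.two_pow_lt_of_gap_lt hi (Finset.mem_filter.1 hr).2).le 2
    rw [← pow_mul, mul_comm, pow_mul, div_pow] at this
    norm_num at this
    exact this
  have h3 := Finset.sum_le_sum h2
  rw [← Finset.mul_sum] at h3
  have h4 : ∑ i ∈ Finset.univ.erase I.best, (I.gap i ^ 2)⁻¹ = I.complexity := rfl
  rw [h4] at h3
  linarith

theorem clog_lastRound_le (hn : 2 ≤ n) :
    (Nat.clog 2 (I.lastRound + 2) : ℝ) ≤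
      5 + 2 * max 0 (Real.log (Real.log I.minGap⁻¹)) := by
  have hpos := I.minGap_pos hn
  have hX : 0 ≤ Real.log I.minGap⁻¹ :=
    Real.log_nonneg ((one_le_inv₀ hpos).2 (I.minGap_le_one hn))
  refine clog_le_log _ ?_
  have h1 := Real.log_le_log (by positivity) (I.two_pow_lastRound_le hn)
  rw [Real.log_pow, div_eq_mul_inv, Real.log_mul (by norm_num) (by positivity)] at h1
  have h2 : (1 / 2 : ℝ) ≤ Real.log 2 := by linarith [Real.log_two_gt_d9]
  by_contra! hcon
  nlinarith

/-- The logarithm of the round number multiplies only the sum of the `4 ^ r`, which is of order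
`minGap ^ (-2)`. -/
theorem roundsCost_le (hn : 2 ≤ n) (c : ℕ) :
    ElimState.roundsCost c I I.lastRound 0 ≤
      2 ^ 28 * I.complexity * (c + ElimState.elimRounds I + 12) +
        2 ^ 16 * (I.minGap ^ 2)⁻¹ * (5 + 2 * max 0 (Real.log (Real.log I.minGap⁻¹))) := by
  have h1 := I.sum_four_pow_mul_near_le hn
  have h2 : ∑ r ∈ Finset.range (I.lastRound + 1), (4 : ℝ) ^ r * Nat.clog 2 (r + 2) ≤
      8 * (I.minGap ^ 2)⁻¹ * (5 + 2 * max 0 (Real.log (Real.log I.minGap⁻¹))) := by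
    calc _ ≤ ∑ r ∈ Finset.range (I.lastRound + 1),
          (4 : ℝ) ^ r * Nat.clog 2 (I.lastRound + 2) := by
          refine Finset.sum_le_sum fun r hr => mul_le_mul_of_nonneg_left ?_ (by positivity)
          exact_mod_cast Nat.clog_mono_right 2 (by have := Finset.mem_range.1 hr; omega)
      _ ≤ 8 * (I.minGap ^ 2)⁻¹ * Nat.clog 2 (I.lastRound + 2) := by
          rw [← Finset.sum_mul]
          refine mul_le_mul_of_nonneg_right ?_ (Nat.cast_nonneg _)
          refine (sum_four_pow_le _ (x := 4 * (I.minGap ^ 2)⁻¹) (by positivity) fun r hr =>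
            ?_).trans (le_of_eq (by ring))
          exact (pow_le_pow_right₀ (by norm_num)
            (Nat.lt_succ_iff.1 (Finset.mem_range.1 hr))).trans (I.four_pow_lastRound_le hn)
      _ ≤ _ := mul_le_mul_of_nonneg_left (I.clog_lastRound_le hn) (by positivity)
  have e : ElimState.roundsCost c I I.lastRound 0 =
      2 ^ 24 * (c + ElimState.elimRounds I + 12) *
        ∑ r ∈ Finset.range (I.lastRound + 1), (4 : ℝ) ^ r * I.near r +
      2 ^ 13 * ∑ r ∈ Finset.range (I.lastRound + 1), (4 : ℝ) ^ r * Nat.clog 2 (r + 2) := by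
    unfold ElimState.roundsCost ElimState.roundCost
    rw [Nat.Ico_zero_eq_range, Finset.mul_sum, Finset.mul_sum, ← Finset.sum_add_distrib]
    exact Finset.sum_congr rfl fun r _ => by ring
  rw [e]
  have h3 := mul_le_mul_of_nonneg_left h1
    (by positivity : (0 : ℝ) ≤ 2 ^ 24 * (c + ElimState.elimRounds I + 12))
  linarith

end BestArmInstance

/-! ### Choice of the confidence levels and the final bounds. -/

/-- The confidence levels of the interleaved elimination procedures. -/
def confidence (δ : ℝ) (i : ℕ) : ℕ := ⌈Real.log δ⁻¹⌉₊ + (3 * i + 20)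

/-- The summand `3 * i` gives the decay `8 ^ (-i)`, which beats the slowdown `2 ^ i` and the linear
growth of the cost of the copies. The summand `20` absorbs constants and guarantees the level that
the cost potential needs. -/
theorem exp_neg_confidence_le {δ : ℝ} (hδ : 0 < δ) (i : ℕ) :
    Real.exp (-(confidence δ i : ℝ)) ≤ δ * ((1 / 8) ^ i * (1 / 2) ^ 20) := by
  refine (exp_neg_add_le _ _).trans ?_
  have e : ((1 : ℝ) / 2) ^ (3 * i + 20) = (1 / 8) ^ i * (1 / 2) ^ 20 := by
    rw [pow_add, pow_mul]; norm_num
  rw [e]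
  refine mul_le_mul_of_nonneg_right ?_ (by positivity)
  rw [← Real.le_log_iff_exp_le hδ]
  have := Nat.le_ceil (Real.log δ⁻¹)
  rw [Real.log_inv] at this ⊢
  linarith

/-- The interleaved elimination procedures. -/
def elimAlgorithm (δ : ℝ) (n : ℕ) (hn : 2 ≤ n) : BanditAlgorithm n :=
  EpochMachine.interleave fun i => elimMachine ⟨0, by omega⟩ (confidence δ i)

section elimAlgorithm

variable {δ : ℝ} {n : ℕ} (I : BestArmInstance n)

/-- A bound for the number of pulls of the copy `i`. -/
def pullBound (δ : ℝ) (i : ℕ) : ℕ :=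
  ⌈ElimState.roundsCost (confidence δ i) I I.lastRound 0⌉₊ + 1

theorem iterate_op_elimMachine_le (hδ : 0 < δ) (hδ1 : δ < 1 / 10) (hn : 2 ≤ n) {K : ℕ}
    (hK : I.classes.card ≤ K + 1) (d : Fin n) (i N : ℕ) (hN : pullBound I δ i ≤ N) :
    ((elimMachine d (confidence δ i)).op I.law)^[N]
      (((elimMachine d (confidence δ i)).unsuccessful I.best).indicator 1)
      ((elimMachine d (confidence δ i)).start (elimMachine d (confidence δ i)).init) ≤
        ENNReal.ofReal ((44 + 4 * K) * (1 / 8) ^ i) := by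
  refine (iterate_op_unsuccessful_le I d (R := I.lastRound) (by unfold confidence; omega)
    (fun r h => I.le_lastRound hn h) ?_).trans (ENNReal.ofReal_le_ofReal ?_)
  · refine (Nat.le_ceil _).trans ?_
    exact_mod_cast (Nat.le_succ _).trans hN
  · have h1 : (I.classes.card : ℝ) ≤ K + 1 := by exact_mod_cast hK
    have h2 := exp_neg_confidence_le hδ i
    have h3 : δ * ((1 / 8 : ℝ) ^ i * (1 / 2) ^ 20) ≤ (1 / 8) ^ i := by
      have : (0 : ℝ) < (1 / 8) ^ i := by positivity
      nlinarith
    exact mul_le_mul (by linarith) (h2.trans h3) (Real.exp_nonneg _) (by positivity)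

theorem isCorrect_elimAlgorithm (hδ : 0 < δ) (hδ1 : δ < 1 / 10) (hn : 2 ≤ n) :
    (elimAlgorithm δ n hn).IsCorrect δ := by
  intro I
  refine le_trans ?_ (EpochMachine.le_runLaw_interleave_returns _ I
    -- Here `K` is the number of classes of the instance itself; it matters only for almost sure
    -- halting, so correctness holds on all instances.
    (fun i N hN => iterate_op_elimMachine_le I hδ hδ1 hn (Nat.le_succ _) _ i N hN) ?_
    (fun i N => iterate_op_mistaken_le I _ _ N))
  · rw [ENNReal.ofReal_sub _ hδ.le, ENNReal.ofReal_one]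
    refine tsub_le_tsub_left ?_ 1
    rw [← tsum_ofReal_mul_half_pow hδ.le]
    refine ENNReal.tsum_le_tsum fun i => ENNReal.ofReal_le_ofReal ?_
    have h1 := exp_neg_confidence_le hδ i
    have h2 : ((1 : ℝ) / 8) ^ i ≤ (1 / 2) ^ i := pow_le_pow_left₀ (by norm_num) (by norm_num) i
    have h3 := mul_le_mul_of_nonneg_left h2 hδ.le
    rw [pow_succ]
    have : 0 ≤ δ * (1 / 8 : ℝ) ^ i := by positivity
    nlinarith
  · rw [← ENNReal.ofReal_zero]
    refine (ENNReal.continuous_ofReal.tendsto _).comp ?_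
    have := (tendsto_pow_atTop_nhds_zero_of_lt_one (by norm_num : (0 : ℝ) ≤ 1 / 8)
      (by norm_num)).const_mul (44 + 4 * (I.classes.card : ℝ))
    simpa using this

theorem one_le_log_inv (hδ : 0 < δ) (hδ1 : δ < 1 / 10) : 1 ≤ Real.log δ⁻¹ := by
  rw [Real.le_log_iff_exp_le (by positivity)]
  have : (10 : ℝ) ≤ δ⁻¹ := by
    rw [le_inv_comm₀ (by norm_num) hδ]; linarith
  linarith [Real.exp_one_lt_d9]

/-- The bound of the theorem, up to the constant. -/
def targetBound (δ : ℝ) : ℝ :=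
  I.complexity * Real.log δ⁻¹ +
    (I.minGap ^ 2)⁻¹ * max 0 (Real.log (Real.log I.minGap⁻¹))

theorem pullBound_le (hδ : 0 < δ) (hδ1 : δ < 1 / 10) (hn : 2 ≤ n) {K : ℕ}
    (hK : I.classes.card ≤ K + 1) (i : ℕ) :
    (pullBound I δ i : ℝ) ≤ 2 ^ 30 * (38 + 3 * K) * (i + 1) * targetBound I δ := by
  have h1 := I.roundsCost_le hn (confidence δ i)
  have hD := one_le_log_inv hδ hδ1
  have hcx := I.one_le_complexity hn
  have hcx2 := I.inv_minGap_sq_le_complexity hn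
  have h2 : (pullBound I δ i : ℝ) ≤
      ElimState.roundsCost (confidence δ i) I I.lastRound 0 + 2 := by
    have := Nat.ceil_lt_add_one
      (ElimState.roundsCost_nonneg (confidence δ i) I 0 (R := I.lastRound))
    unfold pullBound
    push_cast
    linarith
  have h3 : (confidence δ i : ℝ) ≤ Real.log δ⁻¹ + 3 * i + 21 := by
    have := Nat.ceil_lt_add_one (zero_le_one.trans hD)
    unfold confidence
    push_cast
    linarith
  have h4 : (ElimState.elimRounds I : ℝ) ≤ 3 * K + 4 := by
    have : ElimState.elimRounds I ≤ 3 * K + 4 := by unfold ElimState.elimRounds; omega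
    exact_mod_cast this
  have hM : 0 ≤ max 0 (Real.log (Real.log I.minGap⁻¹)) := le_max_left _ _
  unfold targetBound
  generalize max 0 (Real.log (Real.log I.minGap⁻¹)) = M at *
  generalize Real.log δ⁻¹ = D at *
  generalize I.complexity = x at *
  have hz : 0 ≤ (I.minGap ^ 2)⁻¹ := by positivity
  generalize (I.minGap ^ 2)⁻¹ = z at *
  generalize (confidence δ i : ℝ) = c at *
  generalize (ElimState.elimRounds I : ℝ) = H at *
  have hi : (0 : ℝ) ≤ i := Nat.cast_nonneg _
  have hk : (0 : ℝ) ≤ K := Nat.cast_nonneg _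
  generalize (i : ℝ) = i' at *
  generalize (K : ℝ) = k at *
  have hF : 1 ≤ (38 + 3 * k) * (i' + 1) := by nlinarith
  have h5 : c + H + 12 ≤ D * ((38 + 3 * k) * (i' + 1)) := by
    have : c + H + 12 ≤ D + (37 + 3 * k) * (i' + 1) := by nlinarith
    have : (37 + 3 * k) * (i' + 1) ≤ D * ((37 + 3 * k) * (i' + 1)) :=
      le_mul_of_one_le_left (by positivity) hD
    nlinarith
  have h6 : x * (c + H + 12) ≤ x * D * ((38 + 3 * k) * (i' + 1)) := by
    rw [mul_assoc]; exact mul_le_mul_of_nonneg_left h5 (by linarith)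
  have hxD : 1 ≤ x * D := by nlinarith
  have hxz : z ≤ x * D := by nlinarith
  have hzM : 0 ≤ z * M := mul_nonneg hz hM
  have h7 : x * D ≤ x * D * ((38 + 3 * k) * (i' + 1)) := le_mul_of_one_le_right (by linarith) hF
  have h8 : z * M ≤ z * M * ((38 + 3 * k) * (i' + 1)) := le_mul_of_one_le_right hzM hF
  linarith

theorem expectedSamples_elimAlgorithm_le (hδ : 0 < δ) (hδ1 : δ < 1 / 10) (hn : 2 ≤ n) {K : ℕ}
    (hK : I.classes.card ≤ K + 1) :
    (elimAlgorithm δ n hn).expectedSamples I ≤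
      ENNReal.ofReal (2 ^ 30 * (38 + 3 * K) * (32 * (46 + 4 * K)) * targetBound I δ) := by
  refine (EpochMachine.expectedSamples_interleave_le _ I
    (fun i N hN => iterate_op_elimMachine_le I hδ hδ1 hn hK _ i N hN)
    (fun i => Nat.le_add_left _ _)).trans ?_
  have hB : 0 ≤ targetBound I δ := by
    have := one_le_log_inv hδ hδ1
    have := I.one_le_complexity hn
    unfold targetBound
    positivity
  set F : ℝ := 2 ^ 30 * (38 + 3 * K) * targetBound I δ with hF
  have hF0 : 0 ≤ F := by positivity
  have hT : ∀ i, (pullBound I δ i : ℝ≥0∞) ≤ ENNReal.ofReal (F * (i + 1)) := fun i => by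
    rw [← ENNReal.ofReal_natCast]
    refine ENNReal.ofReal_le_ofReal ((pullBound_le I hδ hδ1 hn hK i).trans (le_of_eq ?_))
    rw [hF]; ring
  have h0 : 2 * (pullBound I δ 0 : ℝ≥0∞) ≤ ENNReal.ofReal (2 * F) := by
    rw [ENNReal.ofReal_mul (by norm_num), ENNReal.ofReal_ofNat]
    refine mul_le_mul' le_rfl ((hT 0).trans (le_of_eq (by simp)))
  have h1 : ∀ i : ℕ, 2 ^ (i + 2) * (pullBound I δ (i + 1) : ℝ≥0∞) *
      ENNReal.ofReal ((44 + 4 * K) * (1 / 8) ^ i) ≤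
        ENNReal.ofReal (32 * F * (44 + 4 * K) * (1 / 2) ^ (i + 1)) := by
    intro i
    have e : (2 : ℝ≥0∞) ^ (i + 2) = ENNReal.ofReal (2 ^ (i + 2)) := by
      rw [ENNReal.ofReal_pow (by norm_num), ENNReal.ofReal_ofNat]
    refine (mul_le_mul' (mul_le_mul' e.le (hT (i + 1))) le_rfl).trans ?_
    rw [← ENNReal.ofReal_mul (by positivity), ← ENNReal.ofReal_mul (by positivity)]
    refine ENNReal.ofReal_le_ofReal ?_
    -- The linear factor is traded for a second `2 ^ i`, so that the terms still decay like `2 ^ i *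
    -- 2 ^ i * 8 ^ (-i)`.
    have h2 : ((i + 1 : ℕ) : ℝ) + 1 ≤ 2 ^ (i + 1) := by
      exact_mod_cast Nat.lt_two_pow_self (n := i + 1)
    have h3 : (2 : ℝ) ^ i * 2 ^ i * (1 / 8) ^ i = (1 / 2) ^ i := by
      rw [← mul_pow, ← mul_pow]; norm_num
    calc 2 ^ (i + 2) * (F * (((i + 1 : ℕ) : ℝ) + 1)) * ((44 + 4 * K) * (1 / 8) ^ i)
        ≤ 2 ^ (i + 2) * (F * 2 ^ (i + 1)) * ((44 + 4 * K) * (1 / 8) ^ i) := by gcongr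
      _ = 8 * F * (44 + 4 * K) * ((2 : ℝ) ^ i * 2 ^ i * (1 / 8) ^ i) := by ring
      _ = 8 * F * (44 + 4 * K) * (1 / 2) ^ i := by rw [h3]
      _ ≤ 32 * F * (44 + 4 * K) * (1 / 2) ^ (i + 1) := by
        rw [pow_succ]
        have : 0 ≤ F * (44 + 4 * K) * (1 / 2 : ℝ) ^ i := by positivity
        linarith
  refine (add_le_add h0 (ENNReal.tsum_le_tsum h1)).trans ?_
  rw [tsum_ofReal_mul_half_pow (by positivity), ← ENNReal.ofReal_add (by positivity)
    (by positivity)]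
  refine ENNReal.ofReal_le_ofReal ?_
  rw [show 2 ^ 30 * (38 + 3 * (K : ℝ)) * (32 * (46 + 4 * K)) * targetBound I δ =
    F * (32 * (46 + 4 * K)) by rw [hF]; ring]
  linarith

end elimAlgorithm

end

theorem mainTheorem4 :
    ∃ A : ℝ → (n : ℕ) → 2 ≤ n → BanditAlgorithm n,
      (∀ δ : ℝ, 0 < δ → δ < 1 / 10 → ∀ (n : ℕ) (hn : 2 ≤ n), (A δ n hn).IsCorrect δ) ∧
      ∀ K : ℕ, ∃ C : ℝ, 0 < C ∧
        ∀ δ : ℝ, 0 < δ → δ < 1 / 10 → ∀ (n : ℕ) (hn : 2 ≤ n) (I : BestArmInstance n),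
          I.numClasses ≤ (K : ℕ∞) →
            (A δ n hn).expectedSamples I ≤
              ENNReal.ofReal
                (C * (I.complexity * Real.log δ⁻¹ +
                  (I.minGap ^ 2)⁻¹ * max 0 (Real.log (Real.log I.minGap⁻¹)))) :=
  ⟨elimAlgorithm, fun _ hδ hδ1 _ hn => isCorrect_elimAlgorithm hδ hδ1 hn, fun K =>
    ⟨2 ^ 30 * (38 + 3 * K) * (32 * (46 + 4 * K)), by positivity, fun _ hδ hδ1 _ hn I hI =>
      expectedSamples_elimAlgorithm_le I hδ hδ1 hn (I.card_classes_le hI)⟩⟩
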